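/- Let $p$ be a prime and let $K$ be a field that is complete with respect to a non-archimedean norm $|\cdot|$ with $|p|=1/p$. Let $X$ be an affinoid subdomain of the rigid analytic affine line $\mathbb{A}$ over $K$ with coordinate $x$, let $\partial_x = d/dx$ be the corresponding derivation of $\mathcal{O}(X)$, and let $r(X) := \lim_{k\to\infty} \|\partial_x^k\|^{1/k}$ be its spectral radius on the $K$-Banach algebra $\mathcal{O}(X)$ (it does not depend on the choice of a complete $K$-algebra norm on $\mathcal{O}(X)$). Let $r>0$ be a real number such that $X$ is $\partial_x/r$-admissible, that is, $r > r(X)$. Let $\mathcal{D}(X)$ be the algebra of finite-order differential operators on $X$, i.e. the enveloping algebra of the Lie algebroid $\mathcal{T}(X)=\mathrm{Der}_K(\mathcal{O}(X))$, and let $$\mathcal{D}_r(X) := \mathcal{O}(X)\langle \partial/r\rangle = \Big\{ \sum_{j\ge 0} a_j\partial^j : a_j\in\mathcal{O}(X),\ \lim_{j\to\infty}|a_j|r^j = 0\Big\}, \qquad \Big|\sum_j a_j\partial^j\Big| := \sup_j |a_j| r^j,$$ be the $K$-Banach algebra whose multiplication is the continuous one determined by $\partial a - a\partial = \partial_x(a)$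 for $a\in\mathcal{O}(X)$, together with the canonical $\mathcal{O}(X)$-linear $K$-algebra homomorphism $j:\mathcal{D}(X)\to\mathcal{D}_r(X)$, $\partial_x\mapsto\partial$. For $u\in\mathcal{O}(X)^\times$ and a non-zero integer $d$, let $\theta_{u,d}$ be the $\mathcal{O}(X)$-linear $K$-algebra automorphism of $\mathcal{D}(X)$ such that $$\theta_{u,d}(\delta) = \delta - \frac{1}{d}\,\frac{\delta(u)}{u}\qquad\text{for all } \delta\in\mathcal{T}(X)$$ (formally, the conjugation by a $d$-th root of $u$). **Theorem.** Let $u\in\mathcal{O}(X)^\times$ and let $d$ be an integer with $p\nmid d$. Then $\theta_{u,d}$ extends to a bounded $K$-algebra automorphism of $\mathcal{D}_r(X)$: there is a $K$-algebra automorphism $\Theta$ of $\mathcal{D}_r(X)$ such that $\Theta$ and $\Theta^{-1}$ are bounded and $\Theta\circ j = j\circ\theta_{u,d}$. -/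

import Mathlib

set_option linter.unusedSectionVars false
set_option linter.unusedSimpArgs false

open Filter Topology Polynomial

universe u

noncomputable section

namespace RigidLine

/-- The Tate algebra `K⟨T₁, …, Tₙ⟩`: power series whose coefficients tend to zero. -/
def TateAlgebra (K : Type*) [NormedField K] [IsUltrametricDist K] (n : ℕ) :
    Subalgebra K (MvPowerSeries (Fin n) K) where
  carrier := {f | f.IsRestricted (fun _ => 1)}
  mul_mem' := MvPowerSeries.isRestricted.mul _
  add_mem' := MvPowerSeries.isRestricted.add _
  algebraMap_mem' c := MvPowerSeries.isRestricted_C _ c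

/-- A `K`-affinoid algebra is a quotient of a Tate algebra. -/
def IsAffinoidAlgebra (K : Type*) [NormedField K] [IsUltrametricDist K]
    (B : Type*) [CommRing B] [Algebra K B] : Prop :=
  ∃ (n : ℕ) (φ : TateAlgebra K n →ₐ[K] B), Function.Surjective φ

theorem tendsto_norm_coeff {K : Type*} [NormedField K] [IsUltrametricDist K] {n : ℕ}
    (f : MvPowerSeries (Fin n) K) :
    f ∈ TateAlgebra K n ↔ Tendsto (fun t => ‖MvPowerSeries.coeff t f‖) cofinite (𝓝 0) := by
  change MvPowerSeries.IsRestricted _ f ↔ _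
  simp [MvPowerSeries.IsRestricted, Finsupp.prod]

section Points

variable {K : Type u} [NormedField K] [IsUltrametricDist K]

/-- The closed points of the affine line over `K` are the maximal ideals of `K[X]`. An element `c`
of an affinoid algebra `C` defines a morphism `Sp C → 𝔸`, sending the maximal ideal `m` to the
kernel of `K[X] → C → C / m`, `X ↦ c`. `LandsIn U c` says that its image is contained in `U`. -/
def LandsIn (U : Set (MaximalSpectrum K[X])) {C : Type*} [CommRing C] [Algebra K C] (c : C) :
    Prop :=
  ∀ m : MaximalSpectrum C, ∃ a ∈ U, a.asIdeal = m.asIdeal.comap (aeval (R := K) c)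

/-- `U ⊆ 𝔸` is an affinoid subdomain of the affine line with ring of functions `O`, the
restriction to `U` of the coordinate of `𝔸` being `x ∈ O`: the morphism `Sp O → 𝔸` defined by `x`
has image in `U`, and every morphism from an affinoid variety to `𝔸` with image in `U` factors
uniquely through it. -/
structure IsAffinoidSubdomain (U : Set (MaximalSpectrum K[X])) {O : Type u} [CommRing O]
    [Algebra K O] (x : O) : Prop where
  affinoid : IsAffinoidAlgebra K O
  landsIn : LandsIn U x
  universal : ∀ (C : Type u) [CommRing C] [Algebra K C], IsAffinoidAlgebra K C →
    ∀ c : C, LandsIn U c → ∃! φ : O →ₐ[K] C, φ x = c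

end Points

section Deriv

variable {K : Type u} [NormedField K] [IsUltrametricDist K] {O : Type u} [CommRing O]
  [Algebra K O]

/-- The coefficient of `T₀ ^ k` in an element of `K⟨T₀, …, Tₙ⟩`. -/
def tateCoeff {n : ℕ} (k : ℕ) (f : TateAlgebra K (n + 1)) : TateAlgebra K n :=
  ⟨PowerSeries.coeff k (MvPowerSeries.finSuccEquiv K n f.1), by
    rw [tendsto_norm_coeff]
    have := (tendsto_norm_coeff f.1).1 f.2
    simp_rw [MvPowerSeries.coeff_coeff_finSuccEquiv]
    exact this.comp (Finsupp.cons_right_injective (M := ℕ) k).tendsto_cofinite⟩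

theorem tateCoeff_surj {n : ℕ} (f₀ f₁ : TateAlgebra K n) :
    ∃ f : TateAlgebra K (n + 1), tateCoeff 0 f = f₀ ∧ tateCoeff 1 f = f₁ := by
  let g : MvPowerSeries (Fin (n + 1)) K := fun t =>
    if t 0 = 0 then MvPowerSeries.coeff t.tail f₀.1
    else if t 0 = 1 then MvPowerSeries.coeff t.tail f₁.1 else 0
  have hg : ∀ t, MvPowerSeries.coeff t g = if t 0 = 0 then MvPowerSeries.coeff t.tail f₀.1
    else if t 0 = 1 then MvPowerSeries.coeff t.tail f₁.1 else 0 := fun t => rfl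
  have h₀ := (tendsto_norm_coeff f₀.1).1 f₀.2
  have h₁ := (tendsto_norm_coeff f₁.1).1 f₁.2
  have hmem : g ∈ TateAlgebra K (n + 1) := by
    rw [tendsto_norm_coeff, NormedAddGroup.tendsto_nhds_zero]
    intro ε hε
    have e₀ := (NormedAddGroup.tendsto_nhds_zero.1 h₀) ε hε
    have e₁ := (NormedAddGroup.tendsto_nhds_zero.1 h₁) ε hε
    rw [eventually_cofinite] at *
    refine ((e₀.image (Finsupp.cons 0)).union (e₁.image (Finsupp.cons 1))).subset ?_
    intro t ht
    rw [Set.mem_ofPred_eq, hg] at ht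
    by_cases c₀ : t 0 = 0
    · refine Or.inl ⟨t.tail, ?_, ?_⟩
      · simpa [c₀] using ht
      · exact c₀ ▸ Finsupp.cons_tail t
    · by_cases c₁ : t 0 = 1
      · refine Or.inr ⟨t.tail, ?_, ?_⟩
        · simpa [c₁] using ht
        · exact (congrArg (fun k => Finsupp.cons k t.tail) c₁.symm).trans (Finsupp.cons_tail t)
      · simp [c₀, c₁, hε] at ht
  refine ⟨⟨g, hmem⟩, Subtype.ext ?_, Subtype.ext ?_⟩
  · ext t
    change MvPowerSeries.coeff t (PowerSeries.coeff _ _) = _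
    rw [MvPowerSeries.coeff_coeff_finSuccEquiv, hg]
    simp
  · ext t
    change MvPowerSeries.coeff t (PowerSeries.coeff _ _) = _
    rw [MvPowerSeries.coeff_coeff_finSuccEquiv, hg]
    simp

/-- The homomorphism `f₀ + f₁ T₀ + ⋯ ↦ φ f₀ + φ f₁ ε`. -/
def dualLift {n : ℕ} (φ : TateAlgebra K n →ₐ[K] O) :
    TateAlgebra K (n + 1) →ₐ[K] TrivSqZeroExt O O :=
  have h0 : ∀ f g : TateAlgebra K (n + 1), tateCoeff 0 (f * g) = tateCoeff 0 f * tateCoeff 0 g :=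
    fun f g => Subtype.ext (by simp [tateCoeff])
  have h1 : ∀ f g : TateAlgebra K (n + 1), tateCoeff 1 (f * g) =
      tateCoeff 0 f * tateCoeff 1 g + tateCoeff 1 f * tateCoeff 0 g :=
    fun f g => Subtype.ext (by
      simp [tateCoeff, PowerSeries.coeff_mul, Finset.Nat.antidiagonal_succ])
  have hs : ∀ k (f g : TateAlgebra K (n + 1)), tateCoeff k (f + g) = tateCoeff k f + tateCoeff k g :=
    fun k f g => Subtype.ext (by simp [tateCoeff])
  have hc0 : ∀ a : K, tateCoeff 0 (algebraMap K (TateAlgebra K (n + 1)) a) = algebraMap K _ a :=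
    fun a => Subtype.ext (by simp [tateCoeff, PowerSeries.algebraMap_apply])
  have hc1 : ∀ a : K, tateCoeff 1 (algebraMap K (TateAlgebra K (n + 1)) a) = 0 :=
    fun a => Subtype.ext (by simp [tateCoeff, PowerSeries.algebraMap_apply])
  { toFun := fun f =>
      TrivSqZeroExt.inl (φ (tateCoeff 0 f)) + TrivSqZeroExt.inr (φ (tateCoeff 1 f))
    map_one' := by
      have a := hc0 1
      have b := hc1 1
      rw [map_one] at a b
      simp [a, b]
    map_zero' := by
      have a := hc0 0
      have b := hc1 0
      rw [map_zero] at a b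
      simp [a, b]
    map_add' := fun f g => by
      ext <;> simp [hs]
    map_mul' := fun f g => by
      ext <;> simp [h0, h1]
    commutes' := fun a => by
      ext <;> simp [hc0, hc1, TrivSqZeroExt.algebraMap_eq_inl'] }

theorem isAffinoidAlgebra_dual (h : IsAffinoidAlgebra K O) :
    IsAffinoidAlgebra K (TrivSqZeroExt O O) := by
  obtain ⟨n, φ, hφ⟩ := h
  refine ⟨n + 1, dualLift φ, fun y => ?_⟩
  obtain ⟨f₀, h₀⟩ := hφ y.fst
  obtain ⟨f₁, h₁⟩ := hφ y.snd
  obtain ⟨f, e₀, e₁⟩ := tateCoeff_surj f₀ f₁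
  refine ⟨f, ?_⟩
  change TrivSqZeroExt.inl (φ (tateCoeff 0 f)) + TrivSqZeroExt.inr (φ (tateCoeff 1 f)) = y
  rw [e₀, e₁, h₀, h₁, TrivSqZeroExt.inl_fst_add_inr_snd_eq]

variable {U : Set (MaximalSpectrum K[X])} {x : O}

theorem LandsIn.dual (h : LandsIn U x) (b : O) :
    LandsIn (C := TrivSqZeroExt O O) U (TrivSqZeroExt.inl x + TrivSqZeroExt.inr b) := by
  intro m
  let π : TrivSqZeroExt O O →ₐ[K] O := TrivSqZeroExt.fstHom K O O
  have hπ : Function.Surjective π := fun y => ⟨TrivSqZeroExt.inl y, by simp [π]⟩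
  have hker : RingHom.ker π ≤ m.asIdeal := by
    intro y hy
    have hy0 : y.fst = 0 := hy
    have : y * y = 0 := by
      ext <;> simp [hy0]
    have hm := m.isMaximal.isPrime
    exact (hm.mem_or_mem (this ▸ m.asIdeal.zero_mem : y * y ∈ m.asIdeal)).elim id id
  have hcm : (m.asIdeal.map π).comap π = m.asIdeal := by
    rw [Ideal.comap_map_of_surjective' π hπ]
    exact sup_eq_left.2 hker
  have hmax : (m.asIdeal.map π).IsMaximal := by
    have := m.isMaximal
    refine (Ideal.map_eq_top_or_isMaximal_of_surjective π hπ m.isMaximal).resolve_left ?_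
    intro htop
    rw [htop, Ideal.comap_top] at hcm
    exact m.isMaximal.ne_top hcm.symm
  obtain ⟨a, ha, e⟩ := h ⟨_, hmax⟩
  refine ⟨a, ha, ?_⟩
  rw [e]
  ext f
  simp only [Ideal.mem_comap]
  have hc : ∀ y, π y ∈ m.asIdeal.map π ↔ y ∈ m.asIdeal := fun y => by
    rw [← Ideal.mem_comap, hcm]
  rw [← hc, ← Polynomial.aeval_algHom_apply]
  simp [π]

/-- The homomorphism `f ↦ f + η(f) ε` defined by a derivation `η`. -/
def dualHom (η : Derivation K O O) : O →ₐ[K] TrivSqZeroExt O O where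
  toFun f := TrivSqZeroExt.inl f + TrivSqZeroExt.inr (η f)
  map_one' := by simp
  map_zero' := by simp
  map_add' f g := by ext <;> simp
  map_mul' f g := by
    ext <;> simp
    ring
  commutes' a := by ext <;> simp [TrivSqZeroExt.algebraMap_eq_inl']

theorem derivation_ext (hX : IsAffinoidSubdomain U x) {η η' : Derivation K O O}
    (h : η x = η' x) : η = η' := by
  obtain ⟨φ, -, hu⟩ := hX.universal _ (isAffinoidAlgebra_dual hX.affinoid) _
    (hX.landsIn.dual (η x))
  have h₁ := hu (dualHom η) rfl
  have h₂ := hu (dualHom η') (by rw [h]; rfl)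
  ext f
  have := congrArg TrivSqZeroExt.snd (DFunLike.congr_fun (h₁.trans h₂.symm) f)
  simpa [dualHom] using this

theorem exists_derivation (hX : IsAffinoidSubdomain U x) :
    ∃ η : Derivation K O O, η x = 1 := by
  obtain ⟨φ, hφ, -⟩ := hX.universal _ (isAffinoidAlgebra_dual hX.affinoid) _
    (hX.landsIn.dual 1)
  have hfst : ∀ f, (φ f).fst = f := by
    have := (hX.universal O hX.affinoid x hX.landsIn).unique
      (y₁ := (TrivSqZeroExt.fstHom K O O).comp φ) (y₂ := AlgHom.id K O)
      (by simp [hφ]) rfl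
    exact fun f => DFunLike.congr_fun this f
  refine ⟨Derivation.mk' ((TrivSqZeroExt.sndHom O O).restrictScalars K ∘ₗ φ.toLinearMap) ?_, ?_⟩
  · intro a b
    simp [hfst, mul_comm]
  · simp [hφ]

/-- The derivation `∂ₓ = d/dx` of the ring of functions of an affinoid subdomain of the affine
line with coordinate `x`: the unique `K`-derivation that sends `x` to `1`. -/
def ddx (hX : IsAffinoidSubdomain U x) : Derivation K O O :=
  (exists_derivation hX).choose

theorem ddx_x (hX : IsAffinoidSubdomain U x) : ddx hX x = 1 :=
  (exists_derivation hX).choose_spec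

theorem eq_smul_ddx (hX : IsAffinoidSubdomain U x) (η : Derivation K O O) :
    η = η x • ddx hX :=
  derivation_ext hX (by simp [ddx_x])

end Deriv

section DiffOp

variable (K : Type*) [Field K] (A : Type*) [CommRing A] [Algebra K A]

/-- The defining relations of the enveloping algebra of the `(K, A)`-Lie algebra `Der_K A`, between
the generators `a ∈ A` and `η ∈ Der_K A`. -/
inductive DiffOp.Rel : FreeAlgebra K (A ⊕ Derivation K A A) →
    FreeAlgebra K (A ⊕ Derivation K A A) → Prop
  | const (c : K) :
      Rel (FreeAlgebra.ι K (.inl (algebraMap K A c))) (algebraMap K _ c)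
  | add (a b : A) : Rel (FreeAlgebra.ι K (.inl (a + b)))
      (FreeAlgebra.ι K (.inl a) + FreeAlgebra.ι K (.inl b))
  | mul (a b : A) : Rel (FreeAlgebra.ι K (.inl (a * b)))
      (FreeAlgebra.ι K (.inl a) * FreeAlgebra.ι K (.inl b))
  | add_der (η ξ : Derivation K A A) : Rel (FreeAlgebra.ι K (.inr (η + ξ)))
      (FreeAlgebra.ι K (.inr η) + FreeAlgebra.ι K (.inr ξ))
  | smul_der (a : A) (η : Derivation K A A) : Rel (FreeAlgebra.ι K (.inr (a • η)))
      (FreeAlgebra.ι K (.inl a) * FreeAlgebra.ι K (.inr η))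
  | der_mul (η : Derivation K A A) (a : A) :
      Rel (FreeAlgebra.ι K (.inr η) * FreeAlgebra.ι K (.inl a))
        (FreeAlgebra.ι K (.inl a) * FreeAlgebra.ι K (.inr η) + FreeAlgebra.ι K (.inl (η a)))
  | bracket (η ξ : Derivation K A A) : Rel (FreeAlgebra.ι K (.inr ⁅η, ξ⁆))
      (FreeAlgebra.ι K (.inr η) * FreeAlgebra.ι K (.inr ξ)
        - FreeAlgebra.ι K (.inr ξ) * FreeAlgebra.ι K (.inr η))

/-- The algebra `𝒟 = U(𝒯)` of finite-order differential operators: the enveloping algebra of the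
Lie-Rinehart algebra `𝒯 = Der_K A` of vector fields. For `A` the ring of functions of a smooth
affinoid variety `X` this is `𝒟(X)`. -/
abbrev DiffOp : Type _ := RingQuot (DiffOp.Rel K A)

namespace DiffOp

variable {A}

/-- A function, as a differential operator of order zero. -/
def fn (a : A) : DiffOp K A := RingQuot.mkAlgHom K (Rel K A) (FreeAlgebra.ι K (.inl a))

variable {K}

/-- A vector field, as a differential operator of order one. -/
def vf (η : Derivation K A A) : DiffOp K A :=
  RingQuot.mkAlgHom K (Rel K A) (FreeAlgebra.ι K (.inr η))

theorem fn_algebraMap (c : K) : fn K (algebraMap K A c) = algebraMap K _ c := by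
  simpa [fn] using RingQuot.mkAlgHom_rel K (Rel.const (A := A) c)

theorem fn_add (a b : A) : fn K (a + b) = fn K a + fn K b := by
  simpa [fn, vf] using RingQuot.mkAlgHom_rel K (Rel.add (K := K) a b)

theorem fn_mul (a b : A) : fn K (a * b) = fn K a * fn K b := by
  simpa [fn, vf] using RingQuot.mkAlgHom_rel K (Rel.mul (K := K) a b)

theorem vf_add (η ξ : Derivation K A A) : vf (η + ξ) = vf η + vf ξ := by
  simpa [fn, vf] using RingQuot.mkAlgHom_rel K (Rel.add_der η ξ)

theorem vf_smul (a : A) (η : Derivation K A A) : vf (a • η) = fn K a * vf η := by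
  simpa [fn, vf] using RingQuot.mkAlgHom_rel K (Rel.smul_der a η)

theorem vf_mul_fn (η : Derivation K A A) (a : A) :
    vf η * fn K a = fn K a * vf η + fn K (η a) := by
  simpa [fn, vf] using RingQuot.mkAlgHom_rel K (Rel.der_mul η a)

theorem vf_bracket (η ξ : Derivation K A A) : vf ⁅η, ξ⁆ = vf η * vf ξ - vf ξ * vf η := by
  simpa [fn, vf] using RingQuot.mkAlgHom_rel K (Rel.bracket η ξ)

theorem fn_one : fn K (1 : A) = 1 := by
  have := fn_algebraMap (A := A) (1 : K)
  rwa [map_one, map_one] at this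

/-- The ring homomorphism from functions to differential operators. -/
def fnHom (K : Type*) [Field K] (A : Type*) [CommRing A] [Algebra K A] : A →ₐ[K] DiffOp K A :=
  AlgHom.mk (RingHom.mk' (MonoidHom.mk ⟨fn K, fn_one⟩ fn_mul) fn_add) fn_algebraMap

variable {B : Type*} [Ring B] [Algebra K B]

/-- The universal property of the algebra of differential operators. -/
def lift (f : A →ₐ[K] B) (g : Derivation K A A → B)
    (add : ∀ η ξ, g (η + ξ) = g η + g ξ)
    (smul : ∀ (a : A) η, g (a • η) = f a * g η)
    (comm : ∀ η a, g η * f a = f a * g η + f (η a))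
    (bracket : ∀ η ξ, g ⁅η, ξ⁆ = g η * g ξ - g ξ * g η) : DiffOp K A →ₐ[K] B :=
  RingQuot.liftAlgHom K ⟨FreeAlgebra.lift K (Sum.elim f g), by
    intro y z h
    cases h <;> simp [add, smul, comm, bracket]⟩

section

variable (f : A →ₐ[K] B) (g : Derivation K A A → B)
    (add : ∀ η ξ, g (η + ξ) = g η + g ξ)
    (smul : ∀ (a : A) η, g (a • η) = f a * g η)
    (comm : ∀ η a, g η * f a = f a * g η + f (η a))
    (bracket : ∀ η ξ, g ⁅η, ξ⁆ = g η * g ξ - g ξ * g η)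

theorem lift_fn (a : A) : lift f g add smul comm bracket (fn K a) = f a := by
  simp [lift, fn]

theorem lift_vf (η : Derivation K A A) : lift f g add smul comm bracket (vf η) = g η := by
  simp [lift, vf]

end

theorem hom_ext {f g : DiffOp K A →ₐ[K] B} (h₀ : ∀ a, f (fn K a) = g (fn K a))
    (h₁ : ∀ η, f (vf η) = g (vf η)) : f = g := by
  refine RingQuot.ringQuot_ext' _ _ _ (FreeAlgebra.hom_ext (funext fun s => ?_))
  rcases s with a | η
  · exact h₀ a
  · exact h₁ η

/-- The function `(1/d) (η(u)/u)`. -/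
def dlog (u : Aˣ) (d : ℤ) (η : Derivation K A A) : A :=
  (d : K)⁻¹ • (η (u : A) * ((u⁻¹ : Aˣ) : A))

theorem dlog_bracket (u : Aˣ) (d : ℤ) (η ξ : Derivation K A A) :
    dlog u d ⁅η, ξ⁆ = η (dlog u d ξ) - ξ (dlog u d η) := by
  have h : ∀ η : Derivation K A A, η ((u⁻¹ : Aˣ) : A) =
      -((u⁻¹ : Aˣ) : A) ^ 2 * η (u : A) := fun η => by
    simpa using η.leibniz_of_mul_eq_one (Units.inv_mul u)
  simp only [dlog, Derivation.map_smul, Derivation.leibniz, h, Derivation.commutator_apply,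
    smul_eq_mul, ← smul_sub]
  congr 1
  ring

theorem dlog_inv (u : Aˣ) (d : ℤ) (η : Derivation K A A) :
    dlog u⁻¹ d η = -dlog u d η := by
  have h : η ((u⁻¹ : Aˣ) : A) = -((u⁻¹ : Aˣ) : A) ^ 2 * η (u : A) := by
    simpa using η.leibniz_of_mul_eq_one (Units.inv_mul u)
  have hu : ((u⁻¹ : Aˣ) : A) * (u : A) = 1 := Units.inv_mul u
  simp only [dlog, inv_inv, h, ← smul_neg]
  congr 1
  linear_combination (-((u⁻¹ : Aˣ) : A) * η (u : A)) * hu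

theorem fn_sub (a b : A) : fn K (a - b) = fn K a - fn K b := map_sub (fnHom K A) a b

theorem fn_comm (a b : A) : fn K a * fn K b = fn K b * fn K a := by
  rw [← fn_mul, mul_comm, fn_mul]

/-- The homomorphism `𝒟(X) → 𝒟(X)`, linear over functions, with
`η ↦ η - (1/d) (η(u)/u)` on vector fields `η`. -/
def twistHom (u : Aˣ) (d : ℤ) : DiffOp K A →ₐ[K] DiffOp K A :=
  lift (fnHom K A) (fun η => vf η - fn K (dlog u d η))
    (fun η ξ => by
      have : dlog u d (η + ξ) = dlog u d η + dlog u d ξ := by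
        simp [dlog, add_mul]
      rw [this, vf_add, fn_add]
      abel)
    (fun a η => by
      have : dlog u d (a • η) = a * dlog u d η := by
        simp [dlog, mul_assoc]
      change _ = fn K a * _
      rw [this, vf_smul, fn_mul, mul_sub])
    (fun η a => by
      change _ * fn K a = fn K a * _ + fn K (η a)
      rw [sub_mul, vf_mul_fn, mul_sub, fn_comm]
      abel)
    (fun η ξ => by
      rw [dlog_bracket, vf_bracket, fn_sub, sub_mul, mul_sub, mul_sub, sub_mul, mul_sub, mul_sub,
        vf_mul_fn, vf_mul_fn, fn_comm (dlog u d η)]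
      abel)

theorem twistHom_fn (u : Aˣ) (d : ℤ) (a : A) : twistHom (K := K) u d (fn K a) = fn K a :=
  lift_fn ..

theorem twistHom_vf (u : Aˣ) (d : ℤ) (η : Derivation K A A) :
    twistHom u d (vf η) = vf η - fn K (dlog u d η) :=
  lift_vf ..

theorem twistHom_comp_inv (u : Aˣ) (d : ℤ) :
    (twistHom (K := K) u d).comp (twistHom u⁻¹ d) = AlgHom.id K _ := by
  refine hom_ext (fun a => ?_) (fun η => ?_)
  · simp [twistHom_fn]
  · have h : fn K (-dlog u d η) = -fn K (dlog u d η) := map_neg (fnHom K A) _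
    simp [twistHom_fn, twistHom_vf, dlog_inv, h]

/-- The twisting automorphism `θ_{u,d}` of `𝒟(X)`, formally the conjugation by a `d`-th root of the
unit `u`: it is the identity on functions and sends a vector field `η` to `η - (1/d) (η(u)/u)`. -/
def twist (u : Aˣ) (d : ℤ) : DiffOp K A ≃ₐ[K] DiffOp K A :=
  AlgEquiv.ofAlgHom (twistHom u d) (twistHom u⁻¹ d) (twistHom_comp_inv u d)
    (by simpa using twistHom_comp_inv (K := K) u⁻¹ d)

theorem twist_fn (u : Aˣ) (d : ℤ) (a : A) : twist (K := K) u d (fn K a) = fn K a :=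
  twistHom_fn u d a

theorem twist_vf (u : Aˣ) (d : ℤ) (η : Derivation K A A) :
    twist u d (vf η) = vf η - fn K ((d : K)⁻¹ • (η (u : A) * ((u⁻¹ : Aˣ) : A))) :=
  twistHom_vf u d η

end DiffOp
end DiffOp

section SkewTate

/-- `ρ` is the spectral radius `lim ‖Tᵏ‖^(1/k)` of the bounded operator `T`. -/
def HasSpectralRadius {K V : Type*} [NontriviallyNormedField K] [NormedAddCommGroup V]
    [NormedSpace K V] (T : V →L[K] V) (ρ : ℝ) : Prop :=
  Tendsto (fun k : ℕ => ‖T ^ k‖ ^ (1 / (k : ℝ))) atTop (𝓝 ρ)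

variable {K : Type*} [NontriviallyNormedField K] {A : Type*} [NormedCommRing A] [NormedAlgebra K A]

/-- `δ` is `r`-admissible: it is a bounded operator of spectral radius less than `r`. -/
def IsAdmissible (δ : Derivation K A A) (r : ℝ) : Prop :=
  ∃ (T : A →L[K] A) (ρ : ℝ), (∀ f, T f = δ f) ∧ HasSpectralRadius T ρ ∧ ρ < r

variable {δ : Derivation K A A} {r : ℝ}

theorem IsAdmissible.pos (h : IsAdmissible δ r) : 0 < r := by
  obtain ⟨T, ρ, -, hρ, hr⟩ := h
  exact (ge_of_tendsto' hρ fun k => by positivity).trans_lt hr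

theorem IsAdmissible.bound (h : IsAdmissible δ r) :
    ∃ M : ℝ, 0 ≤ M ∧ ∀ (m : ℕ) (f : A), ‖(δ : A →ₗ[K] A) ^ m • f‖ ≤ M * r ^ m * ‖f‖ := by
  have hr0 := h.pos
  obtain ⟨T, ρ, hT, hρ, hr⟩ := h
  have hTm : ∀ (m : ℕ) (f : A), ((δ : A →ₗ[K] A) ^ m) • f = (T ^ m) f := by
    intro m
    induction m with
    | zero => intro f; simp
    | succ m ih =>
      intro f
      rw [pow_succ, pow_succ, mul_smul, ih]
      change (T ^ m) (δ f) = (T ^ m) (T f)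
      rw [hT]
  have hev : ∀ᶠ k : ℕ in atTop, ‖T ^ k‖ / r ^ k ≤ 1 := by
    filter_upwards [hρ.eventually_lt_const hr, eventually_gt_atTop 0] with k hk hk0
    rw [div_le_one (by positivity)]
    have := pow_le_pow_left₀ (by positivity) hk.le k
    rwa [← Real.rpow_natCast, ← Real.rpow_mul (by positivity), one_div_mul_cancel (by positivity),
      Real.rpow_one] at this
  obtain ⟨N, hN⟩ := eventually_atTop.1 hev
  refine ⟨1 + ∑ k ∈ Finset.range N, ‖T ^ k‖ / r ^ k, by positivity, fun m f => ?_⟩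
  have key : ‖T ^ m‖ / r ^ m ≤ 1 + ∑ k ∈ Finset.range N, ‖T ^ k‖ / r ^ k := by
    by_cases hm : m < N
    · have := Finset.single_le_sum (f := fun k => ‖T ^ k‖ / r ^ k) (fun k _ => by positivity)
        (Finset.mem_range.2 hm)
      linarith
    · have := hN m (not_lt.1 hm)
      have h2 : 0 ≤ ∑ k ∈ Finset.range N, ‖T ^ k‖ / r ^ k := Finset.sum_nonneg fun k _ => by positivity
      linarith
  rw [div_le_iff₀ (by positivity)] at key
  rw [hTm]
  exact ((T ^ m).le_opNorm f).trans (by gcongr)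

/-- The sequences `(aⱼ)` with `‖aⱼ‖ rʲ → 0`. -/
def tateSeq (A : Type*) [NormedCommRing A] (r : ℝ) : Submodule A (ℕ → A) where
  carrier := {a | Tendsto (fun j => ‖a j‖ * r ^ j) atTop (𝓝 0)}
  zero_mem' := by simp
  add_mem' {a b} ha hb := by
    have ha : Tendsto (fun j => ‖a j‖ * r ^ j) atTop (𝓝 0) := ha
    have hb : Tendsto (fun j => ‖b j‖ * r ^ j) atTop (𝓝 0) := hb
    have := ha.norm.add hb.norm
    rw [norm_zero, add_zero] at this
    refine squeeze_zero_norm (fun j => ?_) this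
    simp only [norm_mul, norm_norm, Pi.add_apply, ← add_mul]
    gcongr
    exact norm_add_le _ _
  smul_mem' c a ha := by
    have ha : Tendsto (fun j => ‖a j‖ * r ^ j) atTop (𝓝 0) := ha
    have := (ha.norm.const_mul ‖c‖)
    rw [norm_zero, mul_zero] at this
    refine squeeze_zero_norm (fun j => ?_) this
    simp only [norm_mul, norm_norm, Pi.smul_apply, smul_eq_mul, ← mul_assoc]
    gcongr
    exact norm_mul_le _ _

/-- The skew-Tate algebra `A⟨∂/r⟩`: the series `∑ aⱼ ∂ʲ` with `‖aⱼ‖ rʲ → 0`, represented by their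
sequences of coefficients. -/
def SkewTate (_h : IsAdmissible δ r) : Type _ := tateSeq A r

variable {h : IsAdmissible δ r}

namespace SkewTate

instance : AddCommGroup (SkewTate h) := inferInstanceAs (AddCommGroup (tateSeq A r))
instance : Module A (SkewTate h) := inferInstanceAs (Module A (tateSeq A r))
instance : Module K (SkewTate h) := inferInstanceAs (Module K (tateSeq A r))

/-- The coefficient `aⱼ` of the series `∑ aⱼ ∂ʲ`. -/
def coeff (v : SkewTate h) (j : ℕ) : A := v.1 j

/-- The series with given coefficients. -/
def mk (h : IsAdmissible δ r) (a : ℕ → A) (ha : Tendsto (fun j => ‖a j‖ * r ^ j) atTop (𝓝 0)) :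
    SkewTate h := ⟨a, ha⟩

@[simp] theorem coeff_mk (a : ℕ → A) (ha) (j : ℕ) : (mk h a ha).coeff j = a j := rfl
@[ext] theorem ext {v w : SkewTate h} (e : ∀ j, v.coeff j = w.coeff j) : v = w :=
  Subtype.ext (funext e)
@[simp] theorem coeff_zero (j : ℕ) : (0 : SkewTate h).coeff j = 0 := rfl
@[simp] theorem coeff_add (v w : SkewTate h) (j : ℕ) :
    (v + w).coeff j = v.coeff j + w.coeff j := rfl
@[simp] theorem coeff_neg (v : SkewTate h) (j : ℕ) : (-v).coeff j = -v.coeff j := rfl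
@[simp] theorem coeff_sub (v w : SkewTate h) (j : ℕ) :
    (v - w).coeff j = v.coeff j - w.coeff j := rfl
@[simp] theorem coeff_smul (a : A) (v : SkewTate h) (j : ℕ) :
    (a • v).coeff j = a * v.coeff j := rfl
@[simp] theorem coeff_smul_base (c : K) (v : SkewTate h) (j : ℕ) :
    (c • v).coeff j = c • v.coeff j := rfl

theorem tendsto_coeff (v : SkewTate h) : Tendsto (fun j => ‖v.coeff j‖ * r ^ j) atTop (𝓝 0) := v.2

instance : IsScalarTower K A (SkewTate h) := ⟨fun c a v => by ext j; simp⟩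
instance : SMulCommClass K A (SkewTate h) := ⟨fun c a v => by ext j; simp⟩

instance : Norm (SkewTate h) := ⟨fun v => ⨆ j, ‖v.coeff j‖ * r ^ j⟩

theorem norm_def (v : SkewTate h) : ‖v‖ = ⨆ j, ‖v.coeff j‖ * r ^ j := rfl

theorem bddAbove (v : SkewTate h) : BddAbove (Set.range fun j => ‖v.coeff j‖ * r ^ j) :=
  v.tendsto_coeff.bddAbove_range

theorem coeff_le (v : SkewTate h) (j : ℕ) : ‖v.coeff j‖ * r ^ j ≤ ‖v‖ := le_ciSup v.bddAbove j

theorem norm_le {v : SkewTate h} {C : ℝ} (e : ∀ j, ‖v.coeff j‖ * r ^ j ≤ C) : ‖v‖ ≤ C :=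
  ciSup_le e

theorem norm_nonneg' (v : SkewTate h) : 0 ≤ ‖v‖ :=
  (by have := h.pos; positivity : 0 ≤ ‖v.coeff 0‖ * r ^ 0).trans (v.coeff_le 0)

instance : NormedAddCommGroup (SkewTate h) :=
  NormedAddCommGroup.ofCore (𝕜 := K)
    { norm_nonneg := norm_nonneg'
      norm_smul := fun c v => by
        simp [norm_def, norm_smul, mul_assoc, Real.mul_iSup_of_nonneg]
      norm_triangle := fun v w => norm_le fun j => by
        have := h.pos
        refine le_trans ?_ (add_le_add (v.coeff_le j) (w.coeff_le j))
        rw [← add_mul]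
        gcongr
        exact norm_add_le _ _
      norm_eq_zero_iff := fun v => by
        refine ⟨fun e => ?_, fun e => ?_⟩
        · ext j
          have := h.pos
          have h1 := e ▸ v.coeff_le j
          have h2 : 0 < r ^ j := by positivity
          have h3 : ‖v.coeff j‖ ≤ 0 := by
            by_contra hc
            have := mul_pos (not_le.1 hc) h2
            linarith
          simpa using h3
        · subst e
          simp [norm_def] }

instance : NormedSpace K (SkewTate h) where
  norm_smul_le c v := by simp [norm_def, norm_smul, mul_assoc, Real.mul_iSup_of_nonneg]

theorem norm_smul_fn (a : A) (v : SkewTate h) : ‖a • v‖ ≤ ‖a‖ * ‖v‖ := norm_le fun j => by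
  have := h.pos
  calc ‖a * v.coeff j‖ * r ^ j ≤ ‖a‖ * ‖v.coeff j‖ * r ^ j := by
        gcongr
        exact norm_mul_le _ _
    _ = ‖a‖ * (‖v.coeff j‖ * r ^ j) := by ring
    _ ≤ _ := by
        gcongr
        exact v.coeff_le j

/-- Taking a coefficient is continuous. -/
def coeffL (j : ℕ) : SkewTate h →L[K] A :=
  LinearMap.mkContinuous ⟨⟨fun v => v.coeff j, fun _ _ => rfl⟩, fun _ _ => rfl⟩ ((r ^ j)⁻¹)
    (fun v => by
      have := h.pos
      rw [inv_mul_eq_div, le_div_iff₀ (by positivity)]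
      exact v.coeff_le j)

@[simp] theorem coeffL_apply (j : ℕ) (v : SkewTate h) : coeffL j v = v.coeff j := rfl

/-- Multiplication by a function is continuous. -/
def smulL (a : A) : SkewTate h →L[K] SkewTate h :=
  LinearMap.mkContinuous ⟨⟨fun v => a • v, fun _ _ => smul_add _ _ _⟩, fun _ _ => smul_comm _ _ _⟩
    ‖a‖ (norm_smul_fn a)

instance [IsUltrametricDist A] : IsUltrametricDist (SkewTate h) :=
  IsUltrametricDist.isUltrametricDist_of_forall_norm_add_le_max_norm fun v w => norm_le fun j => by
    have := h.pos
    rw [coeff_add]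
    rcases le_max_iff.1 (IsUltrametricDist.norm_add_le_max (v.coeff j) (w.coeff j)) with e | e
    · exact le_max_of_le_left ((by gcongr : _ ≤ ‖v.coeff j‖ * r ^ j).trans (v.coeff_le j))
    · exact le_max_of_le_right ((by gcongr : _ ≤ ‖w.coeff j‖ * r ^ j).trans (w.coeff_le j))

instance [CompleteSpace A] : CompleteSpace (SkewTate h) := by
  have hr := h.pos
  refine Metric.complete_of_cauchySeq_tendsto fun s hs => ?_
  have hc : ∀ j, ∃ a, Tendsto (fun n => (s n).coeff j) atTop (𝓝 a) := fun j =>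
    cauchySeq_tendsto_of_complete (hs.map (coeffL (K := K) j).uniformContinuous)
  choose a ha using hc
  have key : ∀ ε > 0, ∃ N, ∀ n ≥ N, ∀ j, ‖(s n).coeff j - a j‖ * r ^ j ≤ ε := by
    intro ε hε
    obtain ⟨N, hN⟩ := Metric.cauchySeq_iff.1 hs ε hε
    refine ⟨N, fun n hn j => ?_⟩
    refine le_of_tendsto (((tendsto_const_nhds.sub (ha j)).norm.mul_const (r ^ j)))
      (eventually_atTop.2 ⟨N, fun m hm => ?_⟩)
    have := hN n hn m hm
    rw [dist_eq_norm] at this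
    exact ((s n - s m).coeff_le j).trans this.le
  have hmem : Tendsto (fun j => ‖a j‖ * r ^ j) atTop (𝓝 0) := by
    rw [Metric.tendsto_atTop]
    intro ε hε
    obtain ⟨N, hN⟩ := key (ε / 2) (by positivity)
    obtain ⟨J, hJ⟩ := Metric.tendsto_atTop.1 (s N).tendsto_coeff (ε / 2) (by positivity)
    refine ⟨J, fun j hj => ?_⟩
    have h1 := hN N le_rfl j
    have h2 := hJ j hj
    rw [Real.dist_eq, sub_zero, abs_of_nonneg (by positivity)] at h2 ⊢
    have h3 : ‖a j‖ ≤ ‖(s N).coeff j - a j‖ + ‖(s N).coeff j‖ := by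
      have := norm_sub_le ((s N).coeff j) ((s N).coeff j - a j)
      rw [sub_sub_cancel] at this
      linarith
    have h4 : ‖a j‖ * r ^ j ≤ (‖(s N).coeff j - a j‖ + ‖(s N).coeff j‖) * r ^ j := by gcongr
    linarith
  refine ⟨mk h a hmem, ?_⟩
  rw [Metric.tendsto_atTop]
  intro ε hε
  obtain ⟨N, hN⟩ := key (ε / 2) (by positivity)
  refine ⟨N, fun n hn => ?_⟩
  rw [dist_eq_norm]
  exact (norm_le (hN n hn)).trans_lt (by linarith)

/-- The series `a ∂ⁱ`. -/
def monomial (h : IsAdmissible δ r) (i : ℕ) (a : A) : SkewTate h :=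
  mk h (Pi.single i a) (by
    refine tendsto_const_nhds.congr' ?_
    filter_upwards [eventually_gt_atTop i] with j hj
    simp [Pi.single_eq_of_ne hj.ne'])

@[simp] theorem coeff_monomial (i : ℕ) (a : A) (j : ℕ) :
    (monomial h i a).coeff j = (Pi.single i a : ℕ → A) j := rfl

/-- The operator `δ` on coefficients. -/
def coeffDer (h : IsAdmissible δ r) : SkewTate h →ₗ[K] SkewTate h where
  toFun v := mk h (fun j => δ (v.coeff j)) (by
    obtain ⟨M, hM, hb⟩ := h.bound
    have hr := h.pos
    have := v.tendsto_coeff.const_mul (M * r)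
    rw [mul_zero] at this
    refine squeeze_zero (fun j => by positivity) (fun j => ?_) this
    have := hb 1 (v.coeff j)
    simp only [pow_one] at this
    calc ‖δ (v.coeff j)‖ * r ^ j ≤ M * r * ‖v.coeff j‖ * r ^ j := by
          gcongr
          exact this
      _ = _ := by ring)
  map_add' v w := by ext j; simp
  map_smul' c v := by ext j; simp

/-- The shift `∑ aⱼ ∂ʲ ↦ ∑ aⱼ ∂ʲ⁺¹`. -/
def shift (h : IsAdmissible δ r) : SkewTate h →ₗ[K] SkewTate h where
  toFun v := mk h (fun j => j.casesOn 0 v.coeff) (by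
    have := v.tendsto_coeff.const_mul r
    rw [mul_zero] at this
    rw [← tendsto_add_atTop_iff_nat 1]
    refine this.congr fun j => ?_
    simp only [pow_succ]
    ring)
  map_add' v w := by ext j; cases j <;> simp
  map_smul' c v := by ext j; cases j <;> simp

@[simp] theorem coeff_coeffDer (v : SkewTate h) (j : ℕ) :
    (coeffDer h v).coeff j = δ (v.coeff j) := rfl
@[simp] theorem coeff_shift_zero (v : SkewTate h) : (shift h v).coeff 0 = 0 := rfl
@[simp] theorem coeff_shift_succ (v : SkewTate h) (j : ℕ) :
    (shift h v).coeff (j + 1) = v.coeff j := rfl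

/-- Left multiplication by `∂` on series: as `∂ a = a ∂ + δ(a)`, it is given by
`∂ · ∑ aⱼ ∂ʲ = ∑ δ(aⱼ) ∂ʲ + ∑ aⱼ ∂ʲ⁺¹`. -/
def delMul (h : IsAdmissible δ r) : Module.End K (SkewTate h) := coeffDer h + shift h

theorem norm_shift_le (v : SkewTate h) : ‖shift h v‖ ≤ r * ‖v‖ := norm_le fun j => by
  have hr := h.pos
  cases j with
  | zero => simpa using mul_nonneg hr.le (norm_nonneg v)
  | succ j =>
    rw [coeff_shift_succ]
    calc ‖v.coeff j‖ * r ^ (j + 1) = r * (‖v.coeff j‖ * r ^ j) := by ring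
      _ ≤ _ := by
        gcongr
        exact v.coeff_le j

theorem norm_shift_pow_le (i : ℕ) (v : SkewTate h) : ‖(shift h ^ i) v‖ ≤ r ^ i * ‖v‖ := by
  have hr := h.pos
  induction i with
  | zero => simp
  | succ i ih =>
    rw [pow_succ', Module.End.mul_apply, pow_succ', mul_assoc]
    exact (norm_shift_le _).trans (by gcongr)

theorem coeff_coeffDer_pow (m : ℕ) (v : SkewTate h) (j : ℕ) :
    ((coeffDer h ^ m) v).coeff j = (δ : A →ₗ[K] A) ^ m • v.coeff j := by
  induction m with
  | zero => simp
  | succ m ih =>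
    rw [pow_succ', Module.End.mul_apply, coeff_coeffDer, ih, pow_succ', mul_smul]
    rfl

theorem exists_norm_delMul_pow_le [IsUltrametricDist A] (h : IsAdmissible δ r) :
    ∃ M : ℝ, 0 ≤ M ∧ ∀ (i : ℕ) (v : SkewTate h), ‖(delMul h ^ i) v‖ ≤ M * r ^ i * ‖v‖ := by
  have hr := h.pos
  obtain ⟨M, hM, hb⟩ := h.bound
  refine ⟨M, hM, fun i v => ?_⟩
  have hc : Commute (coeffDer h) (shift h) := by
    refine LinearMap.ext fun w => ?_
    ext j
    cases j <;> simp
  rw [delMul, hc.add_pow, LinearMap.sum_apply]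
  refine IsUltrametricDist.norm_sum_le_of_forall_le_of_nonneg (by positivity) fun m hm => ?_
  have hmi : m ≤ i := Nat.lt_succ_iff.1 (Finset.mem_range.1 hm)
  have e : (coeffDer h ^ m * shift h ^ (i - m) * (i.choose m : Module.End K (SkewTate h))) v =
      i.choose m • (coeffDer h ^ m) ((shift h ^ (i - m)) v) := by
    simp [Module.End.mul_apply, Module.End.natCast_apply]
  rw [e]
  have e2 : ∀ (n : ℕ) (w : SkewTate h), ‖n • w‖ ≤ ‖w‖ := fun n w => by
    simpa using IsUltrametricDist.norm_nsmul_le w n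
  refine (e2 _ _).trans (norm_le fun j => ?_)
  rw [coeff_coeffDer_pow]
  calc _ ≤ M * r ^ m * ‖((shift h ^ (i - m)) v).coeff j‖ * r ^ j := by
        gcongr
        exact hb _ _
    _ = M * r ^ m * (‖((shift h ^ (i - m)) v).coeff j‖ * r ^ j) := by ring
    _ ≤ M * r ^ m * (r ^ (i - m) * ‖v‖) := by
        exact mul_le_mul_of_nonneg_left
          ((coeff_le ((shift h ^ (i - m)) v) j).trans (norm_shift_pow_le _ _)) (by positivity)
    _ = M * (r ^ m * r ^ (i - m)) * ‖v‖ := by ring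
    _ = _ := by rw [← pow_add, Nat.add_sub_cancel' hmi]

variable [IsUltrametricDist A]

/-- `delMul` as a continuous map. -/
def delL (h : IsAdmissible δ r) : SkewTate h →L[K] SkewTate h :=
  LinearMap.mkContinuousOfExistsBound (delMul h) (by
    obtain ⟨M, -, hb⟩ := exists_norm_delMul_pow_le h
    exact ⟨M * r, fun v => by simpa using hb 1 v⟩)

theorem exists_norm_term_le (h : IsAdmissible δ r) : ∃ M : ℝ, 0 ≤ M ∧
    ∀ (v w : SkewTate h) (i : ℕ), ‖v.coeff i • (delMul h ^ i) w‖ ≤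
      M * ‖w‖ * (‖v.coeff i‖ * r ^ i) := by
  obtain ⟨M, hM, hb⟩ := exists_norm_delMul_pow_le h
  refine ⟨M, hM, fun v w i => (norm_smul_fn _ _).trans ?_⟩
  calc _ ≤ ‖v.coeff i‖ * (M * r ^ i * ‖w‖) := by
        gcongr
        exact hb i w
    _ = _ := by ring

variable [CompleteSpace A]

/-- The product `(∑ aᵢ ∂ⁱ) · w = ∑ aᵢ (∂ⁱ · w)`. -/
instance : Mul (SkewTate h) := ⟨fun v w => ∑' i, v.coeff i • (delMul h ^ i) w⟩

theorem mul_def (v w : SkewTate h) : v * w = ∑' i, v.coeff i • (delMul h ^ i) w := rfl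

theorem hasSum_mul (v w : SkewTate h) :
    HasSum (fun i => v.coeff i • (delMul h ^ i) w) (v * w) := by
  refine Summable.hasSum (NonarchimedeanAddGroup.summable_of_tendsto_cofinite_zero ?_)
  obtain ⟨M, hM, hb⟩ := exists_norm_term_le h
  have := v.tendsto_coeff.const_mul (M * ‖w‖)
  rw [mul_zero] at this
  rw [Nat.cofinite_eq_atTop]
  exact squeeze_zero_norm (hb v w) this

theorem exists_norm_mul_le (h : IsAdmissible δ r) :
    ∃ M : ℝ, 0 ≤ M ∧ ∀ v w : SkewTate h, ‖v * w‖ ≤ M * ‖v‖ * ‖w‖ := by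
  obtain ⟨M, hM, hb⟩ := exists_norm_term_le h
  refine ⟨M, hM, fun v w => ?_⟩
  refine IsUltrametricDist.norm_tsum_le_of_forall_le_of_nonneg (by positivity) fun i => ?_
  calc _ ≤ _ := hb v w i
    _ ≤ M * ‖w‖ * ‖v‖ := by
      gcongr
      exact v.coeff_le i
    _ = _ := by ring

theorem mul_add' (u v w : SkewTate h) : u * (v + w) = u * v + u * w := by
  refine (hasSum_mul u (v + w)).unique ?_
  simpa using (hasSum_mul u v).add (hasSum_mul u w)

theorem add_mul' (u v w : SkewTate h) : (u + v) * w = u * w + v * w := by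
  refine (hasSum_mul (u + v) w).unique ?_
  simpa [add_smul] using (hasSum_mul u w).add (hasSum_mul v w)

theorem smul_fn_mul (a : A) (v w : SkewTate h) : (a • v) * w = a • (v * w) := by
  refine (hasSum_mul (a • v) w).unique ?_
  have := (hasSum_mul v w).mapL (smulL (K := K) a)
  simp only [coeff_smul, mul_smul]
  exact this

theorem smul_mul' (c : K) (v w : SkewTate h) : (c • v) * w = c • (v * w) := by
  have := smul_fn_mul (algebraMap K A c) v w
  rwa [algebraMap_smul, algebraMap_smul] at this

theorem mul_smul' (c : K) (v w : SkewTate h) : v * (c • w) = c • (v * w) := by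
  refine (hasSum_mul v (c • w)).unique ?_
  have := (hasSum_mul v w).const_smul c
  simp only [map_smul]
  exact this.congr_fun (fun i => smul_comm _ _ _)

theorem delMul_smul (a : A) (w : SkewTate h) :
    delMul h (a • w) = δ a • w + a • delMul h w := by
  ext j
  cases j
  · simp [delMul]; ring
  · simp [delMul]; ring

theorem monomial_mul (i : ℕ) (a : A) (w : SkewTate h) :
    monomial h i a * w = a • (delMul h ^ i) w := by
  rw [mul_def, tsum_eq_single i]
  · simp
  · intro j hj
    simp [hj]

theorem delMul_mul (v w : SkewTate h) : delMul h v * w = delMul h (v * w) := by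
  have h1 : HasSum (fun i => v.coeff i • (delMul h ^ (i + 1)) w) (shift h v * w) := by
    have := hasSum_mul (shift h v) w
    rw [hasSum_nat_add_iff' 1 |>.symm] at this
    simpa using this
  have h2 : HasSum (fun i => δ (v.coeff i) • (delMul h ^ i) w) (coeffDer h v * w) :=
    hasSum_mul (coeffDer h v) w
  have h3 : HasSum (fun i => delMul h (v.coeff i • (delMul h ^ i) w)) (delMul h (v * w)) :=
    (hasSum_mul v w).mapL (delL h)
  rw [delMul, LinearMap.add_apply, add_mul', ← delMul]
  refine (h2.add h1).unique (h3.congr_fun fun i => ?_)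
  rw [delMul_smul, pow_succ', Module.End.mul_apply]

theorem delMul_pow_mul (i : ℕ) (v w : SkewTate h) :
    (delMul h ^ i) v * w = (delMul h ^ i) (v * w) := by
  induction i with
  | zero => rfl
  | succ i ih => rw [pow_succ', Module.End.mul_apply, delMul_mul, ih, Module.End.mul_apply]

/-- Right multiplication is continuous. -/
def mulRightL (w : SkewTate h) : SkewTate h →L[K] SkewTate h :=
  LinearMap.mkContinuousOfExistsBound
    ⟨⟨fun v => v * w, fun u v => add_mul' u v w⟩, fun c v => smul_mul' c v w⟩ (by
    obtain ⟨M, -, hb⟩ := exists_norm_mul_le h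
    exact ⟨M * ‖w‖, fun v => (hb v w).trans_eq (by ring)⟩)

theorem mul_assoc' (u v w : SkewTate h) : u * v * w = u * (v * w) := by
  have h1 : HasSum (fun i => (u.coeff i • (delMul h ^ i) v) * w) (u * v * w) :=
    (hasSum_mul u v).mapL (mulRightL w)
  refine h1.unique ?_
  simpa [smul_fn_mul, delMul_pow_mul] using hasSum_mul u (v * w)

instance : One (SkewTate h) := ⟨monomial h 0 1⟩

theorem one_def : (1 : SkewTate h) = monomial h 0 1 := rfl

theorem delMul_monomial (i : ℕ) (a : A) :
    delMul h (monomial h i a) = monomial h i (δ a) + monomial h (i + 1) a := by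
  ext j
  cases j with
  | zero => by_cases hi : i = 0 <;> simp [delMul, Pi.single_apply, hi]
  | succ j =>
    by_cases hi : j + 1 = i
    · subst hi
      simp [delMul, Pi.single_apply]
    · simp [delMul, Pi.single_apply, hi]

theorem delMul_pow_one (i : ℕ) : (delMul h ^ i) 1 = monomial h i 1 := by
  induction i with
  | zero => rfl
  | succ i ih =>
    rw [pow_succ', Module.End.mul_apply, ih, delMul_monomial]
    ext j
    simp

theorem mul_one' (v : SkewTate h) : v * 1 = v := by
  ext j
  have h1 : HasSum (fun i => (v.coeff i • (delMul h ^ i) 1).coeff j) ((v * 1).coeff j) :=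
    (hasSum_mul v 1).mapL (coeffL (K := K) j)
  refine h1.unique ?_
  have h2 := hasSum_single (f := fun i => (v.coeff i • (delMul h ^ i) (1 : SkewTate h)).coeff j) j
    (fun i hi => by simp [delMul_pow_one, Pi.single_apply, hi.symm])
  simpa [delMul_pow_one] using h2

theorem one_mul' (v : SkewTate h) : 1 * v = v := by
  simp [one_def, monomial_mul]

instance : Ring (SkewTate h) where
  __ := (inferInstance : AddCommGroup (SkewTate h))
  mul_assoc := mul_assoc'
  one_mul := one_mul'
  mul_one := mul_one'
  left_distrib := mul_add'
  right_distrib := add_mul'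
  zero_mul w := by simp [mul_def]
  mul_zero w := by simp [mul_def]

instance : Algebra K (SkewTate h) := Algebra.ofModule smul_mul' mul_smul'

/-- Functions, as constant series. -/
def fnHom (h : IsAdmissible δ r) : A →ₐ[K] SkewTate h where
  toFun a := monomial h 0 a
  map_one' := rfl
  map_zero' := by ext j; simp
  map_add' a b := by
    ext j
    by_cases hj : j = 0 <;> simp [Pi.single_apply, hj]
  map_mul' a b := by
    rw [monomial_mul]
    ext j
    by_cases hj : j = 0 <;> simp [Pi.single_apply, hj]
  commutes' c := by
    rw [Algebra.algebraMap_eq_smul_one]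
    ext j
    by_cases hj : j = 0 <;> simp [one_def, Pi.single_apply, hj, Algebra.algebraMap_eq_smul_one]

/-- The homomorphism `j : 𝒟(X) → A⟨∂/r⟩` that is the identity on functions and sends `a δ` to
`a ∂`, when every vector field is of this form, with `a` its value at the coordinate `x`. -/
def ofDiffOp (h : IsAdmissible δ r) (x : A) (hx : ∀ η : Derivation K A A, η = η x • δ) :
    DiffOp K A →ₐ[K] SkewTate h :=
  DiffOp.lift (fnHom h) (fun η => monomial h 1 (η x))
    (fun η ξ => by
      ext j
      by_cases hj : j = 1 <;> simp [Pi.single_apply, hj])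
    (fun a η => by
      change _ = monomial h 0 a * _
      rw [monomial_mul]
      ext j
      by_cases hj : j = 1 <;> simp [Pi.single_apply, hj])
    (fun η a => by
      change _ * monomial h 0 a = monomial h 0 a * _ + monomial h 0 (η a)
      have hη : η a = η x * δ a := by
        conv_lhs => rw [hx η]
        simp
      rw [monomial_mul, monomial_mul, pow_one, delMul_monomial, hη]
      ext j
      rcases j with _ | _ | j <;> simp [Pi.single_apply, mul_comm])
    (fun η ξ => by
      have hη : ∀ a, η a = η x * δ a := fun a => by
        conv_lhs => rw [hx η]
        simp
      have hξ : ∀ a, ξ a = ξ x * δ a := fun a => by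
        conv_lhs => rw [hx ξ]
        simp
      rw [monomial_mul, monomial_mul, pow_one, delMul_monomial, delMul_monomial,
        Derivation.commutator_apply, hη (ξ x), hξ (η x)]
      ext j
      rcases j with _ | _ | _ | j <;> simp [Pi.single_apply, mul_comm])

end SkewTate
end SkewTate

section Line

variable {K : Type u} [NontriviallyNormedField K] [IsUltrametricDist K]
  {O : Type u} [NormedCommRing O] [NormedAlgebra K O] [CompleteSpace O] [IsUltrametricDist O]
  {U : Set (MaximalSpectrum K[X])} {x : O} {r : ℝ}

/-- The completion `𝒟_r(X) = 𝒪(X)⟨∂/r⟩` of `𝒟(X)`, for a `∂ₓ/r`-admissible affinoid subdomain `X`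
of the affine line. -/
abbrev Dr (hX : IsAffinoidSubdomain U x) (hr : IsAdmissible (ddx hX) r) : Type u :=
  SkewTate hr

/-- The canonical homomorphism `j : 𝒟(X) → 𝒟_r(X)`, the identity on functions, with
`j(∂ₓ) = ∂`. -/
def toDr (hX : IsAffinoidSubdomain U x) (hr : IsAdmissible (ddx hX) r) :
    DiffOp K O →ₐ[K] Dr hX hr :=
  SkewTate.ofDiffOp hr x (eq_smul_ddx hX)

end Line
end RigidLine

end

/-! Write `δ` for `∂ₓ` and `w = (1/d) δ(u)/u`. The extension of the twist must be the substitution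
`∑ aⱼ ∂ʲ ↦ ∑ aⱼ (∂ - w)ʲ`, so everything depends on a bound `‖(∂ - w)ⁿ‖ ≤ C rⁿ`. Expanding, `(∂ -
w)ⁿ = ∑ (n choose i) fᵢ ∂ⁿ⁻ⁱ`, where `fᵢ` is the `i`-th iterate of `δ - w` at `1`. Binomial
coefficients have norm at most one, so it is enough to show `‖fᵢ‖ ≤ C rⁱ`
(`exists_norm_conjCoeff_dlog_le`).

If `-1/d` is replaced by a natural number `m`, then `fᵢ` becomes `u⁻ᵐ δⁱ(uᵐ)`. Since `p ∤ d`, the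
number `-1/d` is a `p`-adic limit of natural numbers (`exists_natCast_approx`), and each `fᵢ`
depends continuously on `w`. So a bound on `u⁻ᵐ δⁱ(uᵐ)` that is uniform in `m` suffices
(`exists_norm_inv_pow_mul_le`).

These functions are, up to `i!`, the coefficients of the powers `Gᵐ` of the normalised Taylor series
`G = u⁻¹ ∑ δⁱ(u) tⁱ / i!`. By Legendre's formula and admissibility, `G` converges on a closed disc
of radius `R = 1/(s q)`, with `q = p^(1/(p-1))` and `s < r`, and so does the corresponding series
for `u⁻¹`, which is the inverse of `G`. At each point of the Berkovich spectrum of the ring of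
functions, a unit on a closed disc has a strictly dominant constant coefficient
(`coeff_lt_one_of_mul_eq_one`), here `1`. A pointwise strict bound on a function bounds its powers
(`exists_norm_pow_le`), so `G` is power-bounded for the Gauss norm (`powBounded_of_mul_eq_one`).
Multiplying back by `i!` costs only a factor linear in `i`, absorbed by the gap between `s` and `r`.
-/

noncomputable section

namespace RigidLine

/-! ### Multiplicative seminorms with a prescribed value at one element -/

section Berkovich

/-- The lower envelope of a nonempty chain of nonarchimedean power-multiplicative seminorms that
share a multiplicative element is a seminorm of the same kind. -/
theorem exists_ringSeminorm_le_chain {R : Type*} [CommRing R] (a : R) {t : ℝ}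
    {S : Set (R → ℝ)ᵒᵈ}
    (hS : ∀ g ∈ S, ∃ v : RingSeminorm R, (∀ x, v x = OrderDual.ofDual g x) ∧ v 1 ≤ 1 ∧
      IsPowMul v ∧ IsNonarchimedean v ∧ (∀ y, v (a * y) = v a * v y) ∧ v a = t)
    (hc : IsChain (· ≤ ·) S) (hne : S.Nonempty) :
    ∃ v : RingSeminorm R, (∀ g ∈ S, ∀ x, v x ≤ OrderDual.ofDual g x) ∧ v 1 ≤ 1 ∧
      IsPowMul v ∧ IsNonarchimedean v ∧ (∀ y, v (a * y) = v a * v y) ∧ v a = t := by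
  choose! V hV h1 hp hn hm ht using hS
  have : Nonempty S := hne.to_subtype
  -- The order on `S` is reversed, so a chain is directed downwards and the pointwise infimum is a
  -- limit along `atTop`. All the required properties are closed conditions and pass to it.
  have : IsDirectedOrder S := by
    refine ⟨fun y z => ?_⟩
    rcases hc.total y.2 z.2 with e | e
    · exact ⟨z, e, le_rfl⟩
    · exact ⟨y, le_rfl, e⟩
  let F : R → ℝ := fun x => ⨅ g : S, V g x
  have hbdd : ∀ x, BddBelow (Set.range fun g : S => V g x) := fun x =>
    ⟨0, by rintro _ ⟨g, rfl⟩; exact apply_nonneg _ _⟩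
  have lim : ∀ x, Tendsto (fun g : S => V g x) atTop (𝓝 (F x)) := fun x =>
    tendsto_atTop_ciInf (fun y z e => by
      simp only [hV _ y.2, hV _ z.2]
      exact e x) (hbdd x)
  have hF0 : F 0 = 0 := by simp [F]
  have hna : IsNonarchimedean F := fun x y =>
    le_of_tendsto_of_tendsto' (lim (x + y)) ((lim x).max (lim y)) fun g => hn _ g.2 x y
  have hnn : ∀ x, 0 ≤ F x := fun x => ge_of_tendsto' (lim x) fun g => apply_nonneg _ _
  let v : RingSeminorm R :=
    { toFun := F
      map_zero' := hF0
      add_le' := fun x y => (hna x y).trans (max_le_add_of_nonneg (hnn x) (hnn y))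
      neg' := fun x => by simp [F]
      mul_le' := fun x y => le_of_tendsto_of_tendsto' (lim (x * y)) ((lim x).mul (lim y))
        fun g => map_mul_le_mul _ _ _ }
  refine ⟨v, fun g hg x => ?_, ?_, ?_, hna, fun y => ?_, ?_⟩
  · rw [← hV g hg]
    exact ciInf_le (hbdd x) ⟨g, hg⟩
  · exact le_of_tendsto' (lim 1) fun g => h1 _ g.2
  · exact fun x n hn1 => tendsto_nhds_unique (lim (x ^ n))
      (((lim x).pow n).congr fun g => (hp _ g.2 x hn1).symm)
  · exact tendsto_nhds_unique (lim (a * y))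
      (((lim a).mul (lim y)).congr fun g => (hm _ g.2 y).symm)
  · exact tendsto_nhds_unique (lim a) (tendsto_const_nhds.congr fun g => (ht _ g.2).symm)

/-- A power-multiplicative nonarchimedean seminorm dominates a multiplicative one that has the same
value at a given element. -/
theorem exists_mul_ringSeminorm_le {R : Type*} [CommRing R] (f : RingSeminorm R) (hf1 : f 1 ≤ 1)
    (hpm : IsPowMul f) (hna : IsNonarchimedean f) (a : R) (ha : f a ≠ 0) :
    ∃ v : RingSeminorm R, (∀ x, v x ≤ f x) ∧ IsNonarchimedean v ∧ v 1 = 1 ∧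
      (∀ x y, v (x * y) = v x * v y) ∧ v a = f a := by
  -- Zorn's lemma in the reversed order yields a minimal seminorm. Multiplicativity at `a` is part
  -- of the conditions because it protects the value at `a` when the seminorm is made smaller at
  -- another element.
  let S : Set (R → ℝ)ᵒᵈ := {g | ∃ v : RingSeminorm R, (∀ x, v x = OrderDual.ofDual g x) ∧ v 1 ≤ 1 ∧
      IsPowMul v ∧ IsNonarchimedean v ∧ (∀ y, v (a * y) = v a * v y) ∧ v a = f a}
  have hstart : OrderDual.toDual (fun x => seminormFromConst hf1 ha hpm x) ∈ S :=
    ⟨seminormFromConst hf1 ha hpm, fun x => rfl, seminormFromConst_one_le hf1 ha hpm,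
      seminormFromConst_isPowMul hf1 ha hpm, seminormFromConst_isNonarchimedean hf1 ha hpm hna,
      seminormFromConst_const_mul hf1 ha hpm, seminormFromConst_apply_c hf1 ha hpm⟩
  obtain ⟨m, hle, ⟨v, hvm, h1, hp, hn, hmul, hva⟩, hmax⟩ :=
    zorn_le_nonempty₀ S (fun c hcS hc y hy => by
      obtain ⟨v, h0, hv⟩ := exists_ringSeminorm_le_chain a hcS hc ⟨y, hy⟩
      exact ⟨OrderDual.toDual (fun x => v x), ⟨v, fun x => rfl, hv⟩, fun g hg x => h0 g hg x⟩)
      _ hstart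
  have hvmul : ∀ x y, v (x * y) = v x * v y := by
    intro x y
    by_cases hx : v x = 0
    · rw [hx, zero_mul]
      refine le_antisymm ?_ (apply_nonneg _ _)
      simpa [hx] using map_mul_le_mul v x y
    -- The limit of `v (z * x ^ n) / v x ^ n` is a smaller seminorm in `S` that is multiplicative at
    -- `x`; by minimality it is `v` itself.
    · let w := seminormFromConst h1 hx hp
      have hw : ∀ z, w z = v z := fun z => by
        refine le_antisymm (seminormFromConst_le_seminorm h1 hx hp z) ?_
        rw [hvm]
        refine hmax (y := OrderDual.toDual fun x => w x) ⟨w, fun x => rfl,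
          seminormFromConst_one_le h1 hx hp, seminormFromConst_isPowMul h1 hx hp,
          seminormFromConst_isNonarchimedean h1 hx hp hn,
          seminormFromConst_isMul_of_isMul h1 hx hp hmul,
          (seminormFromConst_apply_of_isMul h1 hx hp hmul).trans hva⟩ (fun z => ?_) z
        exact (seminormFromConst_le_seminorm h1 hx hp z).trans_eq (hvm z)
      have := seminormFromConst_const_mul h1 hx hp y
      change w _ = w _ * w _ at this
      rwa [hw, hw, hw] at this
  refine ⟨v, fun x => ?_, hn, ?_, hvmul, hva⟩
  · rw [hvm]
    exact (hle x).trans (seminormFromConst_le_seminorm hf1 ha hpm x)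
  · have := hvmul a 1
    rw [mul_one] at this
    exact mul_left_cancel₀ (hva ▸ ha : v a ≠ 0) (by rw [← this, mul_one])

variable (K : Type*) [NontriviallyNormedField K] {A : Type*} [NormedCommRing A] [NormedAlgebra K A]
  [IsUltrametricDist A]

/-- The norm of the multiplication operator by an element, a seminorm equivalent to the norm. -/
def mulSeminorm : RingSeminorm A where
  toFun a := ‖ContinuousLinearMap.mul K A a‖
  map_zero' := by simp
  add_le' x y := by
    rw [map_add]
    exact norm_add_le _ _
  neg' x := by simp
  mul_le' x y := by
    have e : ContinuousLinearMap.mul K A (x * y) =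
        (ContinuousLinearMap.mul K A x).comp (ContinuousLinearMap.mul K A y) := by
      ext z
      simp [mul_assoc]
    rw [e]
    exact ContinuousLinearMap.opNorm_comp_le _ _

theorem mulSeminorm_def (a : A) : mulSeminorm K a = ‖ContinuousLinearMap.mul K A a‖ := rfl

theorem mulSeminorm_le (a : A) : mulSeminorm K a ≤ ‖a‖ :=
  ContinuousLinearMap.opNorm_mul_apply_le K A a

theorem le_mulSeminorm (a : A) : ‖a‖ ≤ mulSeminorm K a * ‖(1 : A)‖ := by
  simpa [mulSeminorm_def] using (ContinuousLinearMap.mul K A a).le_opNorm 1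

/-- This is the reason for using the operator norm: the given norm of `1` may exceed one, which the
smoothing construction does not allow. -/
theorem mulSeminorm_one_le : mulSeminorm K (1 : A) ≤ 1 :=
  ContinuousLinearMap.opNorm_le_bound _ zero_le_one fun x => by simp

theorem isNonarchimedean_mulSeminorm : IsNonarchimedean (mulSeminorm K : RingSeminorm A) := by
  intro x y
  refine ContinuousLinearMap.opNorm_le_bound _ (le_max_of_le_left (apply_nonneg _ _)) fun z => ?_
  have hx := (ContinuousLinearMap.mul K A x).le_opNorm z
  have hy := (ContinuousLinearMap.mul K A y).le_opNorm z
  rw [← mulSeminorm_def] at hx hy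
  rw [max_mul_of_nonneg _ _ (norm_nonneg z), map_add, add_apply]
  exact (IsUltrametricDist.norm_add_le_max _ _).trans (max_le_max hx hy)

end Berkovich

/-! ### Pointwise bounds and power-boundedness -/

section PowerBounded

/-- The powers of an element are bounded by those of a constant that exceeds its value at every
point of the Berkovich spectrum. -/
theorem exists_norm_pow_le (K : Type*) [NontriviallyNormedField K] {A : Type*} [NormedCommRing A]
    [NormedAlgebra K A] [IsUltrametricDist A] (a : A) {c : ℝ} (hc : 0 < c)
    (h : ∀ v : RingSeminorm A, (∀ x, v x ≤ ‖x‖) → IsNonarchimedean v → v 1 = 1 →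
      (∀ x y, v (x * y) = v x * v y) → v a < c) :
    ∃ C : ℝ, ∀ k : ℕ, ‖a ^ k‖ ≤ C * c ^ k := by
  let μ : RingSeminorm A := mulSeminorm K
  have hμ1 : μ 1 ≤ 1 := mulSeminorm_one_le K
  have hμn : IsNonarchimedean μ := isNonarchimedean_mulSeminorm K
  let f := smoothingSeminorm μ hμ1 hμn
  -- `f` is the spectral seminorm `lim μ(aᵏ)^(1/k)`. Its value at `a` is attained by a
  -- multiplicative seminorm below `f`, hence below the norm, and the hypothesis applies to that
  -- one.
  have hfa : f a < c := by
    by_contra hcon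
    have hca : c ≤ f a := not_lt.1 hcon
    obtain ⟨v, hv, hn, h1, hm, hva⟩ := exists_mul_ringSeminorm_le f (smoothingFun_one_le μ hμ1)
      (isPowMul_smoothingFun μ hμ1) (isNonarchimedean_smoothingFun μ hμ1 hμn) a
      (hc.trans_le hca).ne'
    have := h v (fun x => (hv x).trans ((smoothingFun_le_self μ x).trans (mulSeminorm_le K x)))
      hn h1 hm
    linarith
  have hev : ∀ᶠ k : ℕ in atTop, μ (a ^ k) ≤ c ^ k := by
    filter_upwards [(tendsto_smoothingFun_of_map_one_le_one μ hμ1 a).eventually_lt_const hfa,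
      eventually_gt_atTop 0] with k hk hk0
    have h0 : 0 ≤ μ (a ^ k) := apply_nonneg _ _
    have := pow_le_pow_left₀ (by positivity) hk.le k
    rwa [← Real.rpow_natCast, smoothingSeminormSeq, ← Real.rpow_mul h0,
      one_div_mul_cancel (by positivity), Real.rpow_one] at this
  have hb : BddAbove (Set.range fun k : ℕ => ‖a ^ k‖ / c ^ k) := by
    obtain ⟨N, hN⟩ := eventually_atTop.1 hev
    -- The sum takes care of the finitely many small `k`; the term `‖1‖` is the cost of returning
    -- from the operator norm to the given norm.
    refine ⟨‖(1 : A)‖ + ∑ k ∈ Finset.range N, ‖a ^ k‖ / c ^ k, ?_⟩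
    rintro _ ⟨k, rfl⟩
    have h2 : 0 ≤ ∑ k ∈ Finset.range N, ‖a ^ k‖ / c ^ k :=
      Finset.sum_nonneg fun k _ => by positivity
    by_cases hk : k < N
    · have := Finset.single_le_sum (f := fun k => ‖a ^ k‖ / c ^ k) (fun k _ => by positivity)
        (Finset.mem_range.2 hk)
      have := norm_nonneg (1 : A)
      dsimp only at *
      linarith
    · have h3 : ‖a ^ k‖ / c ^ k ≤ ‖(1 : A)‖ := by
        rw [div_le_iff₀ (by positivity), mul_comm]
        exact (le_mulSeminorm K _).trans (by gcongr; exact hN k (not_lt.1 hk))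
      dsimp only
      linarith
  obtain ⟨C, hC⟩ := hb
  exact ⟨C, fun k => (div_le_iff₀ (by positivity)).1 (hC ⟨k, rfl⟩)⟩

end PowerBounded

/-! ### Gauss norms of power series and units on a closed disc -/

section Gauss

/-- Only finitely many terms reach `x 0`, so the maximum is attained, and finitely often. Taking the
last index gives the strict inequalities that single out one term in the proof of Gauss's lemma. -/
theorem exists_last_max {x : ℕ → ℝ} (hx : Tendsto x atTop (𝓝 0)) (h0 : 0 < x 0) :
    ∃ i, (∀ j, x j ≤ x i) ∧ ∀ j, i < j → x j < x i := by
  have hev : ∀ᶠ j in atTop, x j < x 0 := hx.eventually_lt_const h0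
  obtain ⟨N, hN⟩ := eventually_atTop.1 hev
  have hN0 : 0 < N := by
    by_contra hc
    exact lt_irrefl _ (hN 0 (not_lt.1 hc))
  obtain ⟨k, hk, hmax⟩ := Finset.exists_max_image (Finset.range N) x ⟨0, by simpa using hN0⟩
  have hk' : ∀ j, x j ≤ x k := fun j => by
    by_cases hj : j < N
    · exact hmax j (by simpa using hj)
    · exact (hN j (not_lt.1 hj)).le.trans (hmax 0 (by simpa using hN0))
  have hkS : k ∈ (Finset.range N).filter (fun j => x j = x k) := by
    simpa using hk
  obtain ⟨i, hi, him⟩ := Finset.exists_max_image _ id ⟨k, hkS⟩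
  have hik : x i = x k := (Finset.mem_filter.1 hi).2
  refine ⟨i, fun j => hik ▸ hk' j, fun j hij => lt_of_le_of_ne (hik ▸ hk' j) fun e => ?_⟩
  by_cases hj : j < N
  · have := him j (by simp [hj, e, hik])
    exact absurd hij (not_lt.2 this)
  · have := hN j (not_lt.1 hj)
    have := hk' 0
    rw [← hik, ← e] at this
    linarith

theorem ringSeminorm_sum_lt {ι R : Type*} [CommRing R] {v : RingSeminorm R}
    (hv : IsNonarchimedean v) {c : ℝ} (hc : 0 < c) (s : Finset ι) (f : ι → R)
    (h : ∀ i ∈ s, v (f i) < c) : v (∑ i ∈ s, f i) < c := by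
  classical
  induction s using Finset.induction_on with
  | empty => simpa using hc
  | insert a s ha ih =>
    rw [Finset.sum_insert ha]
    exact (hv _ _).trans_lt (max_lt (h a (by simp)) (ih fun i hi => h i (by simp [hi])))

/-- If a power series over a field with a nonarchimedean multiplicative seminorm is a unit on a
closed disc, its constant coefficient is dominant. -/
theorem coeff_lt_one_of_mul_eq_one {A : Type*} [CommRing A] {v : RingSeminorm A}
    (hn : IsNonarchimedean v) (h1 : v 1 = 1) (hm : ∀ x y, v (x * y) = v x * v y)
    {R : ℝ} (hR : 0 < R) {g h : PowerSeries A} (hgh : g * h = 1)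
    (hg0 : PowerSeries.coeff 0 g = 1) (hh0 : PowerSeries.coeff 0 h = 1)
    (hg : Tendsto (fun i => v (PowerSeries.coeff i g) * R ^ i) atTop (𝓝 0))
    (hh : Tendsto (fun i => v (PowerSeries.coeff i h) * R ^ i) atTop (𝓝 0))
    {i : ℕ} (hi : i ≠ 0) : v (PowerSeries.coeff i g) * R ^ i < 1 := by
  obtain ⟨a, ha, ha'⟩ := exists_last_max hg (by simp [hg0, h1])
  obtain ⟨b, hb, hb'⟩ := exists_last_max hh (by simp [hh0, h1])
  set x : ℕ → ℝ := fun i => v (PowerSeries.coeff i g) * R ^ i with hxdef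
  set y : ℕ → ℝ := fun i => v (PowerSeries.coeff i h) * R ^ i with hydef
  have hx0 : x 0 = 1 := by simp [hxdef, hg0, h1]
  have hy0 : y 0 = 1 := by simp [hydef, hh0, h1]
  have hxa : 0 < x a := by have := ha 0; linarith
  have hyb : 0 < y b := by have := hb 0; linarith
  have hxn : ∀ k, 0 ≤ x k := fun k => mul_nonneg (apply_nonneg _ _) (by positivity)
  have hyn : ∀ k, 0 ≤ y k := fun k => mul_nonneg (apply_nonneg _ _) (by positivity)
  -- If the last dominant index `a` of `g` were positive, the coefficient of degree `a + b` in `g *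
  -- h = 1` would vanish. But its `(a, b)` term strictly exceeds all others: away from it, one of
  -- the two indices lies beyond its last maximum.
  have hab : a = 0 := by
    by_contra hne
    have hc : PowerSeries.coeff (a + b) (g * h) = 0 := by
      rw [hgh, PowerSeries.coeff_one, if_neg (by omega)]
    rw [PowerSeries.coeff_mul, ← Finset.add_sum_erase _ _
      (show (a, b) ∈ Finset.HasAntidiagonal.antidiagonal (a + b) by simp)] at hc
    have hRp : 0 < R ^ (a + b) := by positivity
    have hlt : v (∑ k ∈ (Finset.HasAntidiagonal.antidiagonal (a + b)).erase (a, b),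
        PowerSeries.coeff k.1 g * PowerSeries.coeff k.2 h) < x a * y b / R ^ (a + b) := by
      refine ringSeminorm_sum_lt hn (by positivity) _ _ fun k hk => ?_
      rw [Finset.mem_erase, Finset.HasAntidiagonal.mem_antidiagonal] at hk
      obtain ⟨hk1, hk2⟩ := hk
      rw [lt_div_iff₀ hRp, hm, ← hk2]
      have e : v (PowerSeries.coeff k.1 g) * v (PowerSeries.coeff k.2 h) * R ^ (k.1 + k.2) =
          x k.1 * y k.2 := by
        simp only [hxdef, hydef]
        ring
      rw [e]
      rcases lt_trichotomy k.1 a with c | c | c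
      · exact (mul_le_mul_of_nonneg_right (ha _) (hyn _)).trans_lt
          (mul_lt_mul_of_pos_left (hb' _ (by omega)) hxa)
      · exact absurd (Prod.ext c (by omega)) hk1
      · exact (mul_le_mul_of_nonneg_left (hb _) (hxn _)).trans_lt
          (mul_lt_mul_of_pos_right (ha' _ c) hyb)
    have e2 : v (PowerSeries.coeff a g * PowerSeries.coeff b h) = x a * y b / R ^ (a + b) := by
      rw [hm, eq_div_iff hRp.ne']
      simp only [hxdef, hydef]
      ring
    rw [← e2, eq_neg_of_add_eq_zero_left hc, map_neg_eq_map] at hlt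
    exact lt_irrefl _ hlt
  subst hab
  rw [← hx0]
  exact ha' i (Nat.pos_of_ne_zero hi)

variable {A : Type*} [NormedCommRing A] [IsUltrametricDist A] {R : ℝ}

/-- The Gauss norm of radius `R` of `f` is at most `C`. -/
def GaussLE (R C : ℝ) (f : PowerSeries A) : Prop := ∀ i, ‖PowerSeries.coeff i f‖ * R ^ i ≤ C

theorem GaussLE.add (hR : 0 ≤ R) {C : ℝ} {f g : PowerSeries A} (hf : GaussLE R C f)
    (hg : GaussLE R C g) : GaussLE R C (f + g) := fun i => by
  rw [map_add]
  refine (mul_le_mul_of_nonneg_right (IsUltrametricDist.norm_add_le_max _ _) (by positivity)).trans ?_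
  rw [max_mul_of_nonneg _ _ (by positivity)]
  exact max_le (hf i) (hg i)

theorem GaussLE.nonneg {C : ℝ} {f : PowerSeries A} (hf : GaussLE R C f) : 0 ≤ C := by
  simpa using (norm_nonneg _).trans ((mul_one _).symm.le.trans (pow_zero R ▸ hf 0))

theorem GaussLE.mul (hR : 0 < R) {C D : ℝ} {f g : PowerSeries A} (hf : GaussLE R C f)
    (hg : GaussLE R D g) : GaussLE R (C * D) (f * g) := fun i => by
  have hC := hf.nonneg
  have hD := hg.nonneg
  rw [← le_div_iff₀ (by positivity), PowerSeries.coeff_mul]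
  refine IsUltrametricDist.norm_sum_le_of_forall_le_of_nonneg (by positivity) fun k hk => ?_
  rw [le_div_iff₀ (by positivity), ← Finset.HasAntidiagonal.mem_antidiagonal.1 hk]
  calc _ ≤ ‖PowerSeries.coeff k.1 f‖ * ‖PowerSeries.coeff k.2 g‖ * R ^ (k.1 + k.2) := by
        gcongr
        exact norm_mul_le _ _
    _ = (‖PowerSeries.coeff k.1 f‖ * R ^ k.1) * (‖PowerSeries.coeff k.2 g‖ * R ^ k.2) := by ring
    _ ≤ _ := mul_le_mul (hf _) (hg _) (by positivity) hC

theorem GaussLE.sum (hR : 0 < R) {ι : Type*} {C : ℝ} (hC : 0 ≤ C) (s : Finset ι)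
    {f : ι → PowerSeries A} (h : ∀ i ∈ s, GaussLE R C (f i)) : GaussLE R C (∑ i ∈ s, f i) := by
  classical
  induction s using Finset.induction_on with
  | empty => exact fun i => by simpa using hC
  | insert a s ha ih =>
    rw [Finset.sum_insert ha]
    exact (h a (by simp)).add hR.le (ih fun i hi => h i (by simp [hi]))

theorem GaussLE.nsmul (hR : 0 < R) {C : ℝ} {f : PowerSeries A} (hf : GaussLE R C f) (n : ℕ) :
    GaussLE R C (n • f) := by
  have := GaussLE.sum hR hf.nonneg (Finset.range n) (f := fun _ => f) fun _ _ => hf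
  simpa using this

theorem gaussLE_one (R : ℝ) : GaussLE R ‖(1 : A)‖ (1 : PowerSeries A) := fun i => by
  rw [PowerSeries.coeff_one]
  split_ifs with hi
  · simp [hi]
  · simp

/-- The powers of `f` are bounded for the Gauss norm of radius `R`. -/
def PowBounded (R : ℝ) (f : PowerSeries A) : Prop := ∃ C : ℝ, ∀ k : ℕ, GaussLE R C (f ^ k)

/-- In the binomial expansion of `(f + g) ^ k` the integer coefficients do not increase an
ultrametric norm, and neither does the number of terms, so the product of the two bounds serves for
all `k`. -/
theorem PowBounded.add (hR : 0 < R) {f g : PowerSeries A} (hf : PowBounded R f)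
    (hg : PowBounded R g) : PowBounded R (f + g) := by
  obtain ⟨C, hC⟩ := hf
  obtain ⟨D, hD⟩ := hg
  refine ⟨C * D, fun k => ?_⟩
  rw [add_pow]
  refine GaussLE.sum hR (mul_nonneg (hC 0).nonneg (hD 0).nonneg) _ fun i _ => ?_
  rw [mul_comm (f ^ i * _), ← nsmul_eq_mul]
  exact ((hC i).mul hR (hD _)).nsmul hR _

theorem powBounded_one (R : ℝ) : PowBounded R (1 : PowerSeries A) :=
  ⟨_, fun k => by
    rw [one_pow]
    exact gaussLE_one R⟩

theorem GaussLE.powBounded (hR : 0 < R) {f : PowerSeries A} (hf : GaussLE R 1 f) :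
    PowBounded R f := by
  refine ⟨‖(1 : A)‖, fun k => ?_⟩
  induction k with
  | zero =>
    rw [pow_zero]
    exact gaussLE_one R
  | succ k ih => simpa [pow_succ] using ih.mul hR hf

theorem PowBounded.sum (hR : 0 < R) {ι : Type*} (s : Finset ι)
    {f : ι → PowerSeries A} (h : ∀ i ∈ s, PowBounded R (f i)) : PowBounded R (∑ i ∈ s, f i) := by
  classical
  induction s using Finset.induction_on with
  | empty => exact GaussLE.powBounded hR fun i => by simp
  | insert a s ha ih =>
    rw [Finset.sum_insert ha]
    exact (h a (by simp)).add hR (ih fun i hi => h i (by simp [hi]))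

theorem powBounded_monomial {i : ℕ} {a : A} {C : ℝ} (hR : 0 < R)
    (h : ∀ k : ℕ, ‖a ^ k‖ ≤ C * ((R ^ i)⁻¹) ^ k) : PowBounded R (PowerSeries.monomial i a) := by
  refine ⟨C, fun k => ?_⟩
  have hC : 0 ≤ C := by simpa using (norm_nonneg _).trans (h 0)
  rw [PowerSeries.monomial_pow]
  intro j
  rw [PowerSeries.coeff_monomial]
  split_ifs with hj
  · rw [hj]
    refine (mul_le_mul_of_nonneg_right (h k) (by positivity)).trans_eq ?_
    rw [inv_pow, ← pow_mul, mul_comm k i, mul_assoc, inv_mul_cancel₀ (by positivity), mul_one]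
  · simpa using hC

/-- The powers of a power series that is a unit on a closed disc and has constant coefficient `1`
are bounded. -/
theorem powBounded_of_mul_eq_one (K : Type*) [NontriviallyNormedField K] [NormedAlgebra K A]
    (hR : 0 < R) {g h : PowerSeries A} (hgh : g * h = 1)
    (hg0 : PowerSeries.coeff 0 g = 1) (hh0 : PowerSeries.coeff 0 h = 1)
    (hg : Tendsto (fun i => ‖PowerSeries.coeff i g‖ * R ^ i) atTop (𝓝 0))
    (hh : Tendsto (fun i => ‖PowerSeries.coeff i h‖ * R ^ i) atTop (𝓝 0)) :
    PowBounded R g := by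
  -- Points of the Berkovich spectrum are dominated by the norm, so both series still converge
  -- there, and dominance of the constant term gives the strict bound `(R ^ i)⁻¹` at each point.
  have hmon : ∀ i, i ≠ 0 → PowBounded R (PowerSeries.monomial i (PowerSeries.coeff i g)) := by
    intro i hi
    obtain ⟨C, hC⟩ := exists_norm_pow_le K (PowerSeries.coeff i g) (c := (R ^ i)⁻¹) (by positivity)
      fun v hv hn h1 hm => by
        have lim : ∀ f : PowerSeries A,
            Tendsto (fun i => ‖PowerSeries.coeff i f‖ * R ^ i) atTop (𝓝 0) →
            Tendsto (fun i => v (PowerSeries.coeff i f) * R ^ i) atTop (𝓝 0) := fun f hf =>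
          squeeze_zero (fun i => mul_nonneg (apply_nonneg _ _) (by positivity))
            (fun i => mul_le_mul_of_nonneg_right (hv _) (by positivity)) hf
        have := coeff_lt_one_of_mul_eq_one hn h1 hm hR hgh hg0 hh0 (lim g hg) (lim h hh) hi
        rwa [← lt_div_iff₀ (by positivity), one_div] at this
    exact powBounded_monomial hR hC
  obtain ⟨N, hN⟩ := eventually_atTop.1 (hg.eventually_le_const (zero_lt_one' ℝ))
  -- The truncation of `g`: finitely many power-bounded monomials, with the constant term entered as
  -- `1`, so that it is kept even when `N = 0`. The tail has Gauss norm at most one and is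
  -- power-bounded for that reason.
  let s : PowerSeries A :=
    1 + ∑ i ∈ (Finset.range N).erase 0, PowerSeries.monomial i (PowerSeries.coeff i g)
  have hs : ∀ j, PowerSeries.coeff j s = if j = 0 ∨ j < N then PowerSeries.coeff j g else 0 := by
    intro j
    simp only [s, map_add, map_sum, PowerSeries.coeff_monomial, PowerSeries.coeff_one,
      Finset.sum_ite_eq, Finset.mem_erase, Finset.mem_range]
    by_cases hj : j = 0
    · simp [hj, hg0]
    · simp [hj]
  have htail : GaussLE R 1 (g - s) := by
    intro j
    rw [map_sub, hs]
    split_ifs with hj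
    · simp
    · rw [sub_zero]
      exact hN j (by omega)
  have hsb : PowBounded R s := (powBounded_one R).add hR
    (PowBounded.sum hR _ fun i hi => hmon i (Finset.ne_of_mem_erase hi))
  simpa using hsb.add hR (htail.powBounded hR)

end Gauss

/-! ### Norms of integers and factorials -/

section Factorial

variable {p : ℕ} [Fact p.Prime] {K : Type*} [NormedField K] [IsUltrametricDist K]

theorem norm_intCast_eq_one (hp : ‖(p : K)‖ = (p : ℝ)⁻¹) {d : ℤ} (hd : ¬ (p : ℤ) ∣ d) :
    ‖(d : K)‖ = 1 := by
  have hp1 : 1 < p := (Fact.out : p.Prime).one_lt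
  refine le_antisymm (IsUltrametricDist.norm_intCast_le_one K d) (not_lt.1 fun hlt => ?_)
  -- A Bézout relation between `p` and `d` would give `‖1‖ < 1` if both had norm below one.
  obtain ⟨a, b, hab⟩ := (Nat.prime_iff_prime_int.1 Fact.out).coprime_iff_not_dvd.2 hd
  have e : (a : K) * p + b * d = 1 := by exact_mod_cast congrArg (Int.cast : ℤ → K) hab
  have h1 : ‖(1 : K)‖ < 1 := by
    rw [← e]
    refine (IsUltrametricDist.norm_add_le_max _ _).trans_lt (max_lt ?_ ?_)
    · rw [norm_mul, hp]
      have := IsUltrametricDist.norm_intCast_le_one K a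
      have h2 : (p : ℝ)⁻¹ < 1 := inv_lt_one_of_one_lt₀ (by exact_mod_cast hp1)
      have h3 : (0 : ℝ) ≤ (p : ℝ)⁻¹ := by positivity
      nlinarith [norm_nonneg (a : K)]
    · rw [norm_mul]
      have := IsUltrametricDist.norm_intCast_le_one K b
      nlinarith [norm_nonneg (b : K), norm_nonneg (d : K)]
  simp at h1

theorem norm_natCast_eq (hp : ‖(p : K)‖ = (p : ℝ)⁻¹) {n : ℕ} (hn : n ≠ 0) :
    ‖(n : K)‖ = ((p : ℝ) ^ padicValNat p n)⁻¹ := by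
  have hd : ¬ p ∣ n / p ^ n.factorization p := Nat.not_dvd_ordCompl Fact.out hn
  have h1 : ‖((n / p ^ n.factorization p : ℕ) : K)‖ = 1 := by
    have := norm_intCast_eq_one hp (d := (n / p ^ n.factorization p : ℕ)) (by exact_mod_cast hd)
    rwa [Int.cast_natCast] at this
  conv_lhs => rw [← Nat.ordProj_mul_ordCompl_eq_self n p]
  rw [Nat.cast_mul, norm_mul, h1, mul_one, Nat.cast_pow, norm_pow, hp, inv_pow,
    Nat.factorization_def _ Fact.out]

theorem factorial_cast_ne_zero (hp : ‖(p : K)‖ = (p : ℝ)⁻¹) (n : ℕ) : (n.factorial : K) ≠ 0 := by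
  have hp0 : 0 < p := (Fact.out : p.Prime).pos
  rw [← norm_pos_iff, norm_natCast_eq hp n.factorial_ne_zero]
  positivity

/-- Legendre's formula as an estimate: with `q = p ^ (1 / (p - 1))`, the norm of `n!` is `q⁻ⁿ` up to
a factor of polynomial growth. -/
theorem exists_norm_factorial_bounds (hp : ‖(p : K)‖ = (p : ℝ)⁻¹) :
    ∃ q : ℝ, 0 < q ∧ (∀ n : ℕ, ‖(n.factorial : K)‖⁻¹ ≤ q ^ n) ∧
      ∀ n : ℕ, ‖(n.factorial : K)‖ * q ^ n ≤ p * (n + 1) := by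
  have hp1 : 1 < p := (Fact.out : p.Prime).one_lt
  have hpR : (1 : ℝ) < p := by exact_mod_cast hp1
  obtain ⟨q, hq0, hq⟩ : ∃ q : ℝ, 0 ≤ q ∧ q ^ (p - 1) = p :=
    ⟨(p : ℝ) ^ (((p - 1 : ℕ) : ℝ)⁻¹), by positivity,
      Real.rpow_inv_natCast_pow (by positivity) (by omega)⟩
  have hq1 : 1 ≤ q := by
    by_contra hc
    have := pow_le_one₀ (n := p - 1) hq0 (not_le.1 hc).le
    linarith
  have hqp : 0 < q := by linarith
  -- Legendre's formula: `(p - 1) vₚ(n!)` is `n` minus the digit sum of `n` in base `p`. The digit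
  -- sum is then at most `p - 1` times the number of digits, so its contribution `q ^ (digit sum)`
  -- is at most `p * n` for positive `n`.
  have key : ∀ n : ℕ, (p : ℝ) ^ padicValNat p n.factorial * q ^ (p.digits n).sum = q ^ n := by
    intro n
    rw [← hq, ← pow_mul, sub_one_mul_padicValNat_factorial, ← pow_add,
      Nat.sub_add_cancel (Nat.digit_sum_le p n)]
  have hfac : ∀ n : ℕ, ‖(n.factorial : K)‖ = ((p : ℝ) ^ padicValNat p n.factorial)⁻¹ := fun n =>
    norm_natCast_eq hp n.factorial_ne_zero
  refine ⟨q, hqp, fun n => ?_, fun n => ?_⟩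
  · rw [hfac, inv_inv, ← key]
    exact le_mul_of_one_le_right (by positivity) (one_le_pow₀ hq1)
  · rw [hfac, ← key, inv_mul_cancel_left₀ (by positivity)]
    rcases Nat.eq_zero_or_pos n with rfl | hn
    · simpa using hpR.le
    have hs : (p.digits n).sum ≤ (p - 1) * (p.digits n).length := by
      rw [mul_comm]
      simpa using List.sum_le_card_nsmul (p.digits n) (p - 1) fun x hx =>
        Nat.le_sub_one_of_lt (Nat.digits_lt_base hp1 hx)
    calc q ^ (p.digits n).sum ≤ q ^ ((p - 1) * (p.digits n).length) := pow_le_pow_right₀ hq1 hs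
      _ = (p : ℝ) ^ (p.digits n).length := by rw [pow_mul, hq]
      _ ≤ p * n := by exact_mod_cast Nat.base_pow_length_digits_le p n hp1 hn.ne'
      _ ≤ p * (n + 1) := by gcongr; linarith

/-- As `d` is invertible modulo `pⁿ`, there is a natural number `m` with `d m ≡ -1`; then `m + 1/d =
(d m + 1)/d` has norm at most `p⁻ⁿ`, because `d` has norm one. -/
theorem exists_natCast_approx (hp : ‖(p : K)‖ = (p : ℝ)⁻¹) {d : ℤ} (hd : ¬ (p : ℤ) ∣ d) :
    ∃ m : ℕ → ℕ, Tendsto (fun n => (m n : K)) atTop (𝓝 (-(d : K)⁻¹)) := by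
  have hp1 : 1 < p := (Fact.out : p.Prime).one_lt
  have hd1 := norm_intCast_eq_one hp hd
  have hd0 : (d : K) ≠ 0 := norm_pos_iff.1 (hd1 ▸ one_pos)
  have hm : ∀ n : ℕ, ∃ m : ℕ, ((p ^ n : ℕ) : ℤ) ∣ d * m + 1 := by
    intro n
    have hc : IsCoprime (((p ^ n : ℕ) : ℤ)) d := by
      push_cast
      exact ((Nat.prime_iff_prime_int.1 Fact.out).coprime_iff_not_dvd.2 hd).pow_left
    obtain ⟨a, b, hab⟩ := hc
    have hpos : (0 : ℤ) < ((p ^ n : ℕ) : ℤ) := by positivity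
    -- `b` is the inverse of `d` modulo `pⁿ` given by Bézout; reducing `-b` modulo `pⁿ` makes it
    -- nonnegative.
    refine ⟨((-b) % ((p ^ n : ℕ) : ℤ)).toNat, ?_⟩
    rw [Int.toNat_of_nonneg (Int.emod_nonneg _ hpos.ne')]
    have := Int.mul_ediv_add_emod (-b) ((p ^ n : ℕ) : ℤ)
    exact ⟨a - d * (-b / ((p ^ n : ℕ) : ℤ)), by linear_combination d * this - hab⟩
  choose m hm using hm
  refine ⟨m, tendsto_iff_norm_sub_tendsto_zero.2 ?_⟩
  refine squeeze_zero (fun n => norm_nonneg _) (fun n => ?_)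
    (tendsto_pow_atTop_nhds_zero_of_lt_one (r := (p : ℝ)⁻¹) (by positivity)
      (inv_lt_one_of_one_lt₀ (by exact_mod_cast hp1)))
  obtain ⟨c, hc⟩ := hm n
  have e : (m n : K) - -(d : K)⁻¹ = (d : K)⁻¹ * ((p : K) ^ n * (c : K)) := by
    have : (d : K) * (m n : K) + 1 = (p : K) ^ n * (c : K) := by
      exact_mod_cast congrArg (Int.cast : ℤ → K) hc
    rw [← this]
    field_simp
    ring
  rw [e, norm_mul, norm_inv, hd1, norm_mul, norm_pow, hp, inv_one, one_mul]
  exact mul_le_of_le_one_right (by positivity) (IsUltrametricDist.norm_intCast_le_one K c)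

end Factorial

/-! ### Taylor series along a derivation -/

section Taylor

variable {K : Type*} [Field K] {A : Type*} [CommRing A] [Algebra K A]

/-- The Taylor series `∑ δⁱ(y) tⁱ / i!`. -/
def taylor (δ : Derivation K A A) (y : A) : PowerSeries A :=
  PowerSeries.mk fun i => (i.factorial : K)⁻¹ • ((δ : A →ₗ[K] A) ^ i) y

theorem coeff_taylor (δ : Derivation K A A) (y : A) (i : ℕ) :
    PowerSeries.coeff i (taylor δ y) = (i.factorial : K)⁻¹ • ((δ : A →ₗ[K] A) ^ i) y :=
  PowerSeries.coeff_mk _ _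

theorem coeff_zero_taylor (δ : Derivation K A A) (y : A) :
    PowerSeries.coeff 0 (taylor δ y) = y := by
  simp [coeff_taylor]

variable [CharZero K]

theorem derivative_taylor (δ : Derivation K A A) (y : A) :
    PowerSeries.derivative A (taylor δ y) = taylor δ (δ y) := by
  ext n
  have h0 : ((n : K) + 1) ≠ 0 := by exact_mod_cast n.succ_ne_zero
  have e : ((n : A) + 1) = algebraMap K A (n + 1) := by simp
  rw [PowerSeries.coeff_derivative, coeff_taylor, coeff_taylor, e, mul_comm, ← Algebra.smul_def,
    smul_smul, Nat.factorial_succ, pow_succ]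
  congr 1
  push_cast
  rw [mul_inv, mul_inv_cancel_left₀ h0]

/-- Formally the Taylor map is `exp(tδ)`, and the exponential of a derivation is multiplicative.
Both sides have the same constant term, and differentiating in `t` reduces each further coefficient
to the preceding one by the Leibniz rule; dividing by `n + 1` is possible in characteristic zero. -/
theorem taylor_mul (δ : Derivation K A A) (x y : A) :
    taylor δ (x * y) = taylor δ x * taylor δ y := by
  ext n
  induction n generalizing x y with
  | zero => simp [coeff_zero_taylor, PowerSeries.coeff_mul]
  | succ n ih =>
    have h0 : ((n : K) + 1) ≠ 0 := by exact_mod_cast n.succ_ne_zero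
    have e : ((n : A) + 1) = algebraMap K A (n + 1) := by simp
    have hu : IsUnit ((n : A) + 1) := e ▸ (h0.isUnit.map (algebraMap K A))
    refine hu.mul_left_injective ?_
    simp only [← PowerSeries.coeff_derivative, Derivation.leibniz, derivative_taylor, smul_eq_mul,
      map_add]
    rw [← ih, ← ih, ← map_add]
    congr 1
    ext i
    simp [coeff_taylor]

theorem taylor_one (δ : Derivation K A A) : taylor δ 1 = 1 := by
  ext n
  cases n with
  | zero => simp [coeff_zero_taylor]
  | succ n => simp [coeff_taylor, pow_succ, PowerSeries.coeff_one]

theorem taylor_pow (δ : Derivation K A A) (x : A) (m : ℕ) :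
    taylor δ (x ^ m) = taylor δ x ^ m := by
  induction m with
  | zero => simp [taylor_one]
  | succ m ih => rw [pow_succ, taylor_mul, ih, pow_succ]

end Taylor

/-! ### Iterates of the twisted derivation -/

section Bounds

variable {K : Type*} [NontriviallyNormedField K] {A : Type*} [NormedCommRing A] [NormedAlgebra K A]
  {δ : Derivation K A A} {r : ℝ}

theorem IsAdmissible.exists_lt (h : IsAdmissible δ r) : ∃ s, s < r ∧ IsAdmissible δ s := by
  obtain ⟨T, ρ, hT, hρ, hr⟩ := h
  exact ⟨(ρ + r) / 2, by linarith, T, ρ, hT, hρ, by linarith⟩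

theorem IsAdmissible.continuous (h : IsAdmissible δ r) : Continuous δ := by
  obtain ⟨T, ρ, hT, -, -⟩ := h
  exact T.continuous.congr hT

theorem exists_succ_mul_pow_le {x y : ℝ} (hx : 0 ≤ x) (hxy : x < y) :
    ∃ C : ℝ, 0 ≤ C ∧ ∀ n : ℕ, (n + 1) * x ^ n ≤ C * y ^ n := by
  have hy : 0 < y := hx.trans_lt hxy
  have h1 : x / y < 1 := (div_lt_one hy).2 hxy
  have h0 : 0 ≤ x / y := by positivity
  have := (tendsto_self_mul_const_pow_of_lt_one h0 h1).add
    (tendsto_pow_atTop_nhds_zero_of_lt_one h0 h1)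
  obtain ⟨C, hC⟩ := this.bddAbove_range
  have hC0 := hC ⟨0, rfl⟩
  simp only [Nat.cast_zero, zero_mul, pow_zero, zero_add] at hC0
  refine ⟨C, by linarith, fun n => ?_⟩
  have := hC ⟨n, rfl⟩
  dsimp only at this
  rw [div_pow, ← mul_div_assoc, ← add_div, div_le_iff₀ (by positivity)] at this
  linarith

/-- The coefficient `fᵢ` of the expansion `(∂ - w)ⁿ = ∑ (n choose i) fᵢ ∂ⁿ⁻ⁱ`. -/
def conjCoeff (δ : Derivation K A A) (w : A) : ℕ → A
  | 0 => 1
  | i + 1 => δ (conjCoeff δ w i) - w * conjCoeff δ w i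

theorem tendsto_conjCoeff (hδ : Continuous δ) {w : A} {W : ℕ → A} (hW : Tendsto W atTop (𝓝 w))
    (i : ℕ) : Tendsto (fun n => conjCoeff δ (W n) i) atTop (𝓝 (conjCoeff δ w i)) := by
  induction i with
  | zero => exact tendsto_const_nhds
  | succ i ih => exact ((hδ.tendsto _).comp ih).sub (hW.mul ih)

/-- For `w = -m δ(u)/u` the operator `δ - w` is the conjugate `u⁻ᵐ ∘ δ ∘ uᵐ`, so its iterates at `1`
are `u⁻ᵐ δⁱ(uᵐ)`. This is the sense in which the twist is a conjugation by a power of `u`. -/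
theorem pow_mul_conjCoeff (δ : Derivation K A A) (u : Aˣ) (m i : ℕ) :
    (u : A) ^ m * conjCoeff δ (-(m • (δ u * ((u⁻¹ : Aˣ) : A)))) i =
      ((δ : A →ₗ[K] A) ^ i) ((u : A) ^ m) := by
  induction i with
  | zero => simp [conjCoeff]
  | succ i ih =>
    rw [pow_succ', Module.End.mul_apply, ← ih, conjCoeff, Derivation.coeFn_coe,
      Derivation.leibniz, Derivation.leibniz_pow]
    simp only [smul_eq_mul, nsmul_eq_mul]
    rcases m with _ | m
    · simp
    · have hu : (u : A) * ((u⁻¹ : Aˣ) : A) = 1 := Units.mul_inv u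
      simp only [Nat.add_sub_cancel]
      linear_combination ((u : A) ^ m * conjCoeff δ
        (-(((m + 1 : ℕ) : A) * (δ u * ((u⁻¹ : Aˣ) : A)))) i * ((m + 1 : ℕ) : A) * δ u) * hu

variable {p : ℕ} [Fact p.Prime] [IsUltrametricDist K] [IsUltrametricDist A]

theorem charZero_of_norm_prime (hp : ‖(p : K)‖ = (p : ℝ)⁻¹) : CharZero K :=
  charZero_of_inj_zero fun n hn => by
    by_contra hne
    obtain ⟨m, rfl⟩ := Nat.exists_eq_succ_of_ne_zero hne
    exact factorial_cast_ne_zero hp (m + 1) (by rw [Nat.factorial_succ, Nat.cast_mul, hn, zero_mul])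

/-- The functions `u⁻ᵐ δⁱ(uᵐ)` are bounded by `rⁱ`, uniformly in `m`. -/
theorem exists_norm_inv_pow_mul_le (hp : ‖(p : K)‖ = (p : ℝ)⁻¹) (h : IsAdmissible δ r) (u : Aˣ) :
    ∃ C : ℝ, 0 ≤ C ∧ ∀ m i : ℕ,
      ‖((u⁻¹ : Aˣ) : A) ^ m * ((δ : A →ₗ[K] A) ^ i) ((u : A) ^ m)‖ ≤ C * r ^ i := by
  have := charZero_of_norm_prime hp
  obtain ⟨ρ, hρr, hρ⟩ := h.exists_lt
  have hρ0 := hρ.pos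
  -- Two gaps are needed: `ρ < s` makes the Taylor series converge on the closed disc of radius `R`,
  -- and `s < r` absorbs the linear factor from the factorials.
  obtain ⟨s, hρs, hsr⟩ := exists_between hρr
  have hs0 : 0 < s := hρ0.trans hρs
  obtain ⟨M, hM, hb⟩ := hρ.bound
  obtain ⟨q, hq0, hq1, hq2⟩ := exists_norm_factorial_bounds hp
  let R : ℝ := (s * q)⁻¹
  have hR : 0 < R := by positivity
  -- Formally `G z` is `z(x + t)/z(x)`: its constant coefficient is `1`, and it is multiplicative in
  -- `z`.
  let G : Aˣ → PowerSeries A := fun z => PowerSeries.C ((z⁻¹ : Aˣ) : A) * taylor δ (z : A)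
  have hG : ∀ z i, PowerSeries.coeff i (G z) =
      ((z⁻¹ : Aˣ) : A) * ((i.factorial : K)⁻¹ • ((δ : A →ₗ[K] A) ^ i) (z : A)) := fun z i => by
    rw [PowerSeries.coeff_C_mul, coeff_taylor]
  have hG0 : ∀ z, PowerSeries.coeff 0 (G z) = 1 := fun z => by simp [hG]
  have hlim : ∀ z, Tendsto (fun i => ‖PowerSeries.coeff i (G z)‖ * R ^ i) atTop (𝓝 0) := by
    -- Since `1/‖i!‖ ≤ qⁱ` and `δⁱ` grows at most like `ρⁱ`, the terms are bounded by a constant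
    -- times `(ρ/s)ⁱ`.
    intro z
    have h1 := (tendsto_pow_atTop_nhds_zero_of_lt_one (r := ρ / s) (by positivity)
      ((div_lt_one hs0).2 hρs)).const_mul (‖((z⁻¹ : Aˣ) : A)‖ * (M * ‖(z : A)‖))
    rw [mul_zero] at h1
    refine squeeze_zero (fun i => by positivity) (fun i => ?_) h1
    have h2 : ‖((δ : A →ₗ[K] A) ^ i) (z : A)‖ ≤ M * ρ ^ i * ‖(z : A)‖ := hb i z
    calc ‖PowerSeries.coeff i (G z)‖ * R ^ i
        ≤ ‖((z⁻¹ : Aˣ) : A)‖ * (q ^ i * (M * ρ ^ i * ‖(z : A)‖)) * R ^ i := by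
          gcongr
          rw [hG]
          refine (norm_mul_le _ _).trans ?_
          gcongr
          rw [norm_smul, norm_inv]
          exact mul_le_mul (hq1 i) h2 (norm_nonneg _) (by positivity)
      _ = _ := by
          simp only [R, inv_pow, mul_pow, div_pow]
          field_simp
  have hmul : G u * G u⁻¹ = 1 := by
    have e : G u * G u⁻¹ = PowerSeries.C (((u⁻¹ : Aˣ) : A) * (u : A)) *
        (taylor δ (u : A) * taylor δ ((u⁻¹ : Aˣ) : A)) := by
      simp only [G, inv_inv, map_mul]
      ring
    rw [e, ← taylor_mul, Units.inv_mul, Units.mul_inv, taylor_one, map_one, one_mul]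
  obtain ⟨C, hC⟩ := powBounded_of_mul_eq_one K hR hmul (hG0 u) (hG0 _) (hlim u) (hlim _)
  have hC0 := (hC 0).nonneg
  obtain ⟨D, hD0, hD⟩ := exists_succ_mul_pow_le hs0.le hsr
  refine ⟨C * p * D, by positivity, fun m i => ?_⟩
  have hcoeff : PowerSeries.coeff i (G u ^ m) = (i.factorial : K)⁻¹ •
      (((u⁻¹ : Aˣ) : A) ^ m * ((δ : A →ₗ[K] A) ^ i) ((u : A) ^ m)) := by
    rw [mul_pow, ← map_pow, ← taylor_pow, PowerSeries.coeff_C_mul, coeff_taylor, mul_smul_comm]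
  have h1 := hC m i
  have hf := norm_pos_iff.2 (factorial_cast_ne_zero hp i)
  rw [hcoeff, norm_smul, norm_inv, inv_mul_eq_div, div_mul_eq_mul_div, div_le_iff₀ hf] at h1
  simp only [R, inv_pow] at h1
  rw [← div_eq_mul_inv, div_le_iff₀ (by positivity), mul_pow] at h1
  -- The bound for the coefficients of `Gᵐ` does not involve `m`; from here on only `i!` is
  -- restored.
  calc _ ≤ C * ‖(i.factorial : K)‖ * (s ^ i * q ^ i) := h1
    _ = C * s ^ i * (‖(i.factorial : K)‖ * q ^ i) := by ring
    _ ≤ C * s ^ i * (p * (i + 1)) := by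
      exact mul_le_mul_of_nonneg_left (hq2 i) (by positivity)
    _ = C * p * ((i + 1) * s ^ i) := by ring
    _ ≤ C * p * (D * r ^ i) := by
      exact mul_le_mul_of_nonneg_left (hD i) (by positivity)
    _ = _ := by ring

/-- The iterates of `δ - (1/d) u'/u` on the constant function `1` are bounded by `rⁱ`. -/
theorem exists_norm_conjCoeff_dlog_le (hp : ‖(p : K)‖ = (p : ℝ)⁻¹) (h : IsAdmissible δ r) (u : Aˣ)
    {d : ℤ} (hd : ¬ (p : ℤ) ∣ d) :
    ∃ C : ℝ, 0 ≤ C ∧ ∀ i : ℕ, ‖conjCoeff δ (DiffOp.dlog u d δ) i‖ ≤ C * r ^ i := by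
  obtain ⟨C, hC0, hC⟩ := exists_norm_inv_pow_mul_le hp h u
  obtain ⟨m, hm⟩ := exists_natCast_approx hp hd
  refine ⟨C, hC0, fun i => ?_⟩
  -- Natural exponents `m n` tending to `-1/d` make the conjugations by `u ^ m n` approximate the
  -- twist; for each `i` the uniform bound survives in the limit.
  have hW : Tendsto (fun n => -(m n • (δ u * ((u⁻¹ : Aˣ) : A)))) atTop
      (𝓝 (DiffOp.dlog u d δ)) := by
    have := (hm.smul_const (δ u * ((u⁻¹ : Aˣ) : A))).neg
    rw [neg_smul, neg_neg] at this
    simpa only [Nat.cast_smul_eq_nsmul, DiffOp.dlog] using this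
  refine le_of_tendsto' (tendsto_conjCoeff h.continuous hW i).norm fun n => ?_
  have := hC (m n) i
  rwa [← pow_mul_conjCoeff, ← mul_assoc, ← mul_pow, Units.inv_mul, one_pow, one_mul] at this

end Bounds

/-! ### The substitution `∂ ↦ ∂ - w` -/

namespace SkewTate

variable {K : Type*} [NontriviallyNormedField K] {A : Type*} [NormedCommRing A] [NormedAlgebra K A]
  {δ : Derivation K A A} {r : ℝ} {h : IsAdmissible δ r} [IsUltrametricDist A] [CompleteSpace A]

/-- The operator `∂ - w`. -/
def delSub (h : IsAdmissible δ r) (w : A) : SkewTate h := monomial h 1 1 - monomial h 0 w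

theorem delSub_mul (w : A) (v : SkewTate h) : delSub h w * v = delMul h v - w • v := by
  rw [delSub, sub_mul, monomial_mul, monomial_mul, one_smul, pow_one, pow_zero, Module.End.one_apply]

/-- By induction on `n`: left multiplication by `∂ - w` acts on each coefficient through `δ - w` and
adds the shifted series, and the two contributions combine by Pascal's rule. -/
theorem coeff_delSub_pow (w : A) (n j : ℕ) :
    (delSub h w ^ n).coeff j = n.choose j • conjCoeff δ w (n - j) := by
  induction n generalizing j with
  | zero =>
    rw [pow_zero, one_def]
    cases j <;> simp [conjCoeff]
  | succ n ih =>
    -- For `j > n` the truncated difference `n - j` has no meaning, but the binomial coefficients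
    -- vanish.
    have step : ∀ j, n.choose j • (δ (conjCoeff δ w (n - j)) - w * conjCoeff δ w (n - j)) =
        n.choose j • conjCoeff δ w (n + 1 - j) := fun j => by
      by_cases hj : j ≤ n
      · rw [Nat.succ_sub hj]
        rfl
      · rw [Nat.choose_eq_zero_of_lt (not_le.1 hj), zero_smul, zero_smul]
    rw [pow_succ', delSub_mul, delMul, LinearMap.add_apply, coeff_sub, coeff_add, coeff_smul,
      coeff_coeffDer, ih, map_nsmul, mul_smul_comm]
    cases j with
    | zero => simpa [smul_sub] using step 0
    | succ j =>
      rw [coeff_shift_succ, ih, add_sub_right_comm, ← smul_sub, step, Nat.add_sub_add_right,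
        Nat.choose_succ_succ, add_smul, add_comm]

theorem norm_delSub_pow_le {w : A} {C : ℝ} (hC : ∀ i : ℕ, ‖conjCoeff δ w i‖ ≤ C * r ^ i) (n : ℕ) :
    ‖delSub h w ^ n‖ ≤ C * r ^ n := by
  have hr := h.pos
  have hC0 : 0 ≤ C := by simpa using (norm_nonneg _).trans (hC 0)
  refine norm_le fun j => ?_
  rw [coeff_delSub_pow]
  by_cases hj : j ≤ n
  · calc _ ≤ ‖conjCoeff δ w (n - j)‖ * r ^ j := by
          gcongr
          simpa using IsUltrametricDist.norm_nsmul_le (conjCoeff δ w (n - j)) (n.choose j)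
      _ ≤ C * r ^ (n - j) * r ^ j := by
          gcongr
          exact hC _
      _ = _ := by rw [mul_assoc, ← pow_add, Nat.sub_add_cancel hj]
  · rw [Nat.choose_eq_zero_of_lt (not_le.1 hj)]
    simp only [zero_smul, norm_zero, zero_mul]
    positivity

theorem hasSum_monomial (v : SkewTate h) : HasSum (fun i => monomial h i (v.coeff i)) v := by
  have := hasSum_mul v 1
  simp only [mul_one, delMul_pow_one] at this
  refine this.congr_fun fun i => ?_
  ext j
  by_cases hj : j = i
  · subst hj
    simp
  · simp [Pi.single_eq_of_ne hj]

/-- Continuous linear maps that agree on the monomials are equal. -/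
theorem eq_of_monomial {f g : SkewTate h →L[K] SkewTate h}
    (e : ∀ i a, f (monomial h i a) = g (monomial h i a)) (v : SkewTate h) : f v = g v :=
  ((hasSum_monomial v).mapL f).unique
    (((hasSum_monomial v).mapL g).congr_fun fun i => e i _)

theorem hasSum_twistFun {w : A} {C : ℝ} (hC : ∀ i : ℕ, ‖conjCoeff δ w i‖ ≤ C * r ^ i)
    (v : SkewTate h) :
    HasSum (fun i => v.coeff i • delSub h w ^ i) (∑' i, v.coeff i • delSub h w ^ i) := by
  refine Summable.hasSum (NonarchimedeanAddGroup.summable_of_tendsto_cofinite_zero ?_)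
  have := v.tendsto_coeff.const_mul C
  rw [mul_zero] at this
  rw [Nat.cofinite_eq_atTop]
  refine squeeze_zero_norm (fun i => (norm_smul_fn _ _).trans ?_) this
  calc _ ≤ ‖v.coeff i‖ * (C * r ^ i) := by
        gcongr
        exact norm_delSub_pow_le hC i
    _ = _ := by ring

variable {w : A} {C : ℝ} (hC : ∀ i : ℕ, ‖conjCoeff δ w i‖ ≤ C * r ^ i)

/-- The substitution `∑ aⱼ ∂ʲ ↦ ∑ aⱼ (∂ - w)ʲ`, as a continuous linear map. -/
def twistL : SkewTate h →L[K] SkewTate h :=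
  LinearMap.mkContinuous
    { toFun := fun v => ∑' i, v.coeff i • delSub h w ^ i
      map_add' := fun v v' => (hasSum_twistFun hC (v + v')).unique (by
        simpa [add_smul] using (hasSum_twistFun hC v).add (hasSum_twistFun hC v'))
      map_smul' := fun c v => (hasSum_twistFun hC (c • v)).unique (by
        simpa using (hasSum_twistFun hC v).const_smul c) }
    C (fun v => by
      have hC0 : 0 ≤ C := by simpa using (norm_nonneg _).trans (hC 0)
      refine IsUltrametricDist.norm_tsum_le_of_forall_le_of_nonneg (by positivity) fun i => ?_
      refine (norm_smul_fn _ _).trans ?_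
      calc _ ≤ ‖v.coeff i‖ * (C * r ^ i) := by
            gcongr
            exact norm_delSub_pow_le hC i
        _ = C * (‖v.coeff i‖ * r ^ i) := by ring
        _ ≤ _ := by
            gcongr
            exact v.coeff_le i)

theorem hasSum_twistL (v : SkewTate h) :
    HasSum (fun i => v.coeff i • delSub h w ^ i) (twistL hC v) :=
  hasSum_twistFun hC v

theorem twistL_monomial (i : ℕ) (a : A) : twistL hC (monomial h i a) = a • delSub h w ^ i := by
  refine (hasSum_twistL hC _).unique ?_
  simpa using hasSum_single (f := fun j => (monomial h i a).coeff j • delSub h w ^ j) i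
    fun j hj => by simp [hj]

theorem twistL_smul (a : A) (v : SkewTate h) : twistL hC (a • v) = a • twistL hC v := by
  refine (hasSum_twistL hC (a • v)).unique ?_
  have := (hasSum_twistL hC v).mapL (smulL (K := K) a)
  simp only [coeff_smul, mul_smul]
  exact this

/-- The commutation of `∂ - w` with functions, in the form of the action on a product. -/
theorem delSub_mul_smul (a : A) (v : SkewTate h) :
    delSub h w * (a • v) = δ a • v + a • (delSub h w * v) := by
  rw [delSub_mul, delSub_mul, delMul_smul, smul_sub, smul_comm w a]
  abel

/-- `∂ - w` has the same commutator with functions as `∂`, because functions commute with each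
other. The substitution therefore turns left multiplication by `∂` into left multiplication by `∂ -
w`. -/
theorem twistL_delMul (v : SkewTate h) : twistL hC (delMul h v) = delSub h w * twistL hC v := by
  have h1 : HasSum (fun i => v.coeff i • delSub h w ^ (i + 1)) (twistL hC (shift h v)) := by
    have := hasSum_twistL hC (shift h v)
    rw [hasSum_nat_add_iff' 1 |>.symm] at this
    simpa using this
  have h2 : HasSum (fun i => δ (v.coeff i) • delSub h w ^ i) (twistL hC (coeffDer h v)) :=
    hasSum_twistL hC (coeffDer h v)
  have h3 : HasSum (fun i => delSub h w * (v.coeff i • delSub h w ^ i))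
      (delSub h w * twistL hC v) := by
    have := ((hasSum_twistL hC v).mapL (delL h)).sub ((hasSum_twistL hC v).mapL (smulL (K := K) w))
    rw [delSub_mul]
    exact this.congr_fun fun i => delSub_mul _ _
  rw [delMul, LinearMap.add_apply, map_add]
  refine (h2.add h1).unique (h3.congr_fun fun i => ?_)
  rw [delSub_mul_smul, pow_succ']

theorem twistL_delMul_pow (i : ℕ) (v : SkewTate h) :
    twistL hC ((delMul h ^ i) v) = delSub h w ^ i * twistL hC v := by
  induction i with
  | zero => simp
  | succ i ih => rw [pow_succ', Module.End.mul_apply, twistL_delMul, ih, pow_succ', mul_assoc]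

/-- The product is `∑ aᵢ (∂ⁱ · v')`; the substitution is continuous, linear over functions, and
compatible with left multiplication by powers of `∂`, so it can be applied term by term. -/
theorem twistL_mul (v v' : SkewTate h) : twistL hC (v * v') = twistL hC v * twistL hC v' := by
  have h1 : HasSum (fun i => twistL hC (v.coeff i • (delMul h ^ i) v')) (twistL hC (v * v')) :=
    (hasSum_mul v v').mapL (twistL hC)
  have h2 : HasSum (fun i => (v.coeff i • delSub h w ^ i) * twistL hC v')
      (twistL hC v * twistL hC v') :=
    (hasSum_twistL hC v).mapL (mulRightL (twistL hC v'))
  refine h1.unique (h2.congr_fun fun i => ?_)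
  rw [twistL_smul, twistL_delMul_pow, smul_fn_mul]

/-- The substitution `∑ aⱼ ∂ʲ ↦ ∑ aⱼ (∂ - w)ʲ`, as a homomorphism of algebras. -/
def twistAlgHom : SkewTate h →ₐ[K] SkewTate h :=
  AlgHom.ofLinearMap (twistL hC : SkewTate h →ₗ[K] SkewTate h)
    (by
      change twistL hC (monomial h 0 1) = 1
      rw [twistL_monomial, pow_zero, one_smul])
    (twistL_mul hC)

theorem twistAlgHom_apply (v : SkewTate h) : twistAlgHom hC v = twistL hC v := rfl

theorem ofDiffOp_fn (x : A) (hx : ∀ η : Derivation K A A, η = η x • δ) (a : A) :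
    ofDiffOp h x hx (DiffOp.fn K a) = monomial h 0 a :=
  DiffOp.lift_fn ..

theorem ofDiffOp_vf (x : A) (hx : ∀ η : Derivation K A A, η = η x • δ) (η : Derivation K A A) :
    ofDiffOp h x hx (DiffOp.vf η) = monomial h 1 (η x) :=
  DiffOp.lift_vf ..

/-- Two algebra homomorphisms out of the enveloping algebra are compared on functions and vector
fields. On a vector field `η = η(x) δ`, the logarithmic derivative is scaled by the same `η(x)`. -/
theorem twistAlgHom_ofDiffOp (x : A) (hx : ∀ η : Derivation K A A, η = η x • δ) (u : Aˣ) (d : ℤ)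
    (hC : ∀ i : ℕ, ‖conjCoeff δ (DiffOp.dlog u d δ) i‖ ≤ C * r ^ i) (P : DiffOp K A) :
    twistAlgHom hC (ofDiffOp h x hx P) = ofDiffOp h x hx (DiffOp.twist u d P) := by
  refine DFunLike.congr_fun (f := (twistAlgHom hC).comp (ofDiffOp h x hx))
    (g := (ofDiffOp h x hx).comp (DiffOp.twist u d).toAlgHom) (DiffOp.hom_ext (fun a => ?_)
      fun η => ?_) P
  · change twistL hC (ofDiffOp h x hx (DiffOp.fn K a)) =
      ofDiffOp h x hx (DiffOp.twist u d (DiffOp.fn K a))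
    rw [DiffOp.twist_fn, ofDiffOp_fn, twistL_monomial, pow_zero, one_def]
    ext j
    by_cases hj : j = 0 <;> simp [Pi.single_apply, hj]
  · change twistL hC (ofDiffOp h x hx (DiffOp.vf η)) =
      ofDiffOp h x hx (DiffOp.twistHom u d (DiffOp.vf η))
    have hη : DiffOp.dlog u d η = η x * DiffOp.dlog u d δ := by
      conv_lhs => rw [hx η]
      simp [DiffOp.dlog, mul_assoc]
    rw [DiffOp.twistHom_vf, map_sub, ofDiffOp_fn, ofDiffOp_vf, twistL_monomial, pow_one, delSub, hη]
    ext j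
    rcases j with _ | _ | j <;> simp [Pi.single_apply]

/-- The composite sends `∂` to `(∂ - w) + w = ∂`, is linear over functions, and is continuous, so
agreement on the monomials `a ∂ⁱ` is enough. -/
theorem twistAlgHom_comp_of_neg {w : A} {C C' : ℝ} (hC : ∀ i : ℕ, ‖conjCoeff δ w i‖ ≤ C * r ^ i)
    (hC' : ∀ i : ℕ, ‖conjCoeff δ (-w) i‖ ≤ C' * r ^ i) :
    (twistAlgHom (h := h) hC).comp (twistAlgHom hC') = AlgHom.id K _ := by
  refine AlgHom.ext fun v => eq_of_monomial (f := (twistL hC).comp (twistL hC'))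
    (g := ContinuousLinearMap.id K _) (fun i a => ?_) v
  have e : twistL hC (delSub h (-w)) = monomial h 1 1 := by
    rw [delSub, map_sub, twistL_monomial, twistL_monomial, delSub]
    ext j
    rcases j with _ | _ | j <;> simp [Pi.single_apply, one_def]
  have e2 : twistL hC (delSub h (-w) ^ i) = monomial h i 1 := by
    change twistAlgHom hC _ = _
    rw [map_pow, twistAlgHom_apply, e, ← delMul_pow_one i]
    induction i with
    | zero => rfl
    | succ i ih => rw [pow_succ', ih, monomial_mul, one_smul, pow_one, pow_succ' (delMul h),
        Module.End.mul_apply]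
  change twistL hC (twistL hC' (monomial h i a)) = monomial h i a
  rw [twistL_monomial, twistL_smul, e2]
  ext j
  by_cases hj : j = i <;> simp [Pi.single_apply, hj]

end SkewTate

end RigidLine

end

open RigidLine in
theorem mainTheorem11 {p : ℕ} [Fact p.Prime]
    {K : Type u} [NontriviallyNormedField K] [IsUltrametricDist K] [CompleteSpace K]
    (hp : ‖(p : K)‖ = (p : ℝ)⁻¹)
    (U : Set (MaximalSpectrum K[X]))
    {O : Type u} [NormedCommRing O] [NormedAlgebra K O] [IsUltrametricDist O] [CompleteSpace O]
    (x : O) (hX : IsAffinoidSubdomain U x)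
    {r : ℝ} (hr : 0 < r) (hadm : IsAdmissible (ddx hX) r)
    (u : Oˣ) (d : ℤ) (hd : ¬ (p : ℤ) ∣ d) :
    ∃ Θ : Dr hX hadm ≃ₐ[K] Dr hX hadm,
      (∃ C : ℝ, ∀ Q, ‖Θ Q‖ ≤ C * ‖Q‖) ∧
      (∃ C : ℝ, ∀ Q, ‖Θ.symm Q‖ ≤ C * ‖Q‖) ∧
      ∀ P : DiffOp K O, Θ (toDr hX hadm P) = toDr hX hadm (DiffOp.twist u d P) := by
  obtain ⟨C, -, hC⟩ := exists_norm_conjCoeff_dlog_le hp hadm u hd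
  -- The inverse is the substitution `∂ ↦ ∂ + w`, which is the twist by `u⁻¹`; the same estimate
  -- makes it bounded.
  obtain ⟨D, -, hD⟩ := exists_norm_conjCoeff_dlog_le hp hadm u⁻¹ hd
  rw [DiffOp.dlog_inv] at hD
  have hC' : ∀ i : ℕ, ‖conjCoeff (ddx hX) (- -DiffOp.dlog u d (ddx hX)) i‖ ≤ C * r ^ i := by
    rwa [neg_neg]
  refine ⟨AlgEquiv.ofAlgHom (SkewTate.twistAlgHom hC) (SkewTate.twistAlgHom hD)
    (SkewTate.twistAlgHom_comp_of_neg hC hD) ?_, ⟨_, (SkewTate.twistL hC).le_opNorm⟩,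
    ⟨_, (SkewTate.twistL hD).le_opNorm⟩, SkewTate.twistAlgHom_ofDiffOp x _ u d hC⟩
  have := SkewTate.twistAlgHom_comp_of_neg (h := hadm) hD hC'
  simpa only [neg_neg] using this
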